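/- Let $0<q\le p$ with $p^2+q^2<1$, and suppose that there is $\tilde\delta\in(0,1)$ such that $$\mathcal S_{p,q}(\delta):=p^{2+\delta}+q^{2+\delta}-1-\tfrac{2+\delta}{2}\,(p^2+q^2-1)<0\qquad\text{for all }0<\delta<\tilde\delta .$$ Let $\lambda\in(0,2)$ be the exponent with $p^\lambda+q^\lambda=1$. Let $g_0\ge 0$ be a density on $\mathbb R$ with $$\int g_0\,dv=1,\quad \int v\,g_0\,dv=0,\quad \int v^2g_0\,dv=1,\quad \int |v|^{2+\tilde\delta}g_0\,dv<\infty ,$$ and write $\hat h(\xi)=\int_{\mathbb R}e^{-i\xi v}h(v)\,dv$. Let $g=g(v,t)$, $t\ge 0$, be the weak solution with initial density $g_0$ of $$\partial_t\hat g(\xi,t)+\tfrac12(p^2+q^2-1)\,\xi\,\partial_\xi\hat g(\xi,t)=\hat g(p\xi,t)\,\hat g(q\xi,t)-\hat g(\xi,t),$$ that is: $g(\cdot,t)\ge0$ is integrable with finite first moment for each $t\ge 0$, $g(\cdot,0)=g_0$, and for every bounded $C^1$ function $\Phi:\mathbb R\to\mathbb R$ with bounded derivative, $\int\Phi(v)\,g(v,t)\,dv\to\int\Phi(v)\,g_0(v)\,dv$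 as $t\to0^+$ and, for all $t>0$, $$\frac{d}{dt}\int\Phi(v)\,g(v,t)\,dv+\tfrac12(p^2+q^2-1)\int v\,\Phi'(v)\,g(v,t)\,dv=\iint g(v,t)\,g(w,t)\,\bigl(\Phi(pv+qw)-\Phi(v)\bigr)\,dw\,dv .$$ Suppose that for some $R,\nu,\beta>0$ $$|\hat g_0(\xi)|\le e^{-\beta|\xi|^\nu}\qquad\text{for }|\xi|>R .$$ Then there exist $\rho>0$ and $\kappa>0$ such that for all $t\ge0$ $$|\hat g(\xi,t)|\le e^{-\kappa\xi^2}\ \text{ for }|\xi|\le\rho,\qquad |\hat g(\xi,t)|\le e^{-\kappa|\xi|^{\min(\nu,\lambda)}}\ \text{ for }|\xi|>\rho .$$ -/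

import Mathlib

open MeasureTheory Filter Topology

noncomputable section

namespace MaxwellModel

/-- The Fourier transform `ĥ(ξ) = ∫ e^{-iξv} h(v) dv` (no factor `2π`). -/
def fourierTr (h : ℝ → ℝ) (ξ : ℝ) : ℂ :=
  ∫ v : ℝ, Complex.exp (-((ξ * v : ℝ) : ℂ) * Complex.I) * (h v : ℂ)

/-- `S_{p,q}(δ) = p^{2+δ} + q^{2+δ} - 1 - ((2+δ)/2) (p² + q² - 1)`. -/
def S (p q δ : ℝ) : ℝ :=
  p ^ (2 + δ) + q ^ (2 + δ) - 1 - (2 + δ) / 2 * (p ^ 2 + q ^ 2 - 1)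

/-- A normalized density: nonnegative, unit mass, zero mean, unit energy. -/
structure Normalized (h : ℝ → ℝ) : Prop where
  nonneg : 0 ≤ᵐ[volume] h
  integrable : Integrable h
  integrable_mul : Integrable (fun v : ℝ => v * h v)
  integrable_sq : Integrable (fun v : ℝ => v ^ 2 * h v)
  mass : ∫ v : ℝ, h v = 1
  mean : ∫ v : ℝ, v * h v = 0
  energy : ∫ v : ℝ, v ^ 2 * h v = 1

/-- Test functions: bounded `C¹` functions with bounded derivative. -/
structure IsTest (Φ : ℝ → ℝ) : Prop where
  contDiff : ContDiff ℝ 1 Φ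
  bounded : ∃ C : ℝ, ∀ v, |Φ v| ≤ C
  deriv_bounded : ∃ C : ℝ, ∀ v, |deriv Φ v| ≤ C

/-- The collision operator in weak form,
`∬ h(v) h(w) (Φ(v*) - Φ(v)) dw dv` with `v* = p v + q w`. -/
def collision (p q : ℝ) (h Φ : ℝ → ℝ) : ℝ :=
  ∫ v : ℝ, ∫ w : ℝ, h v * h w * (Φ (p * v + q * w) - Φ v)

/-- `g t v` is a weak solution, with initial density `g₀`, of the scaled equation
`∂ₜĝ(ξ,t) + ½ (p² + q² - 1) ξ ∂_ξ ĝ(ξ,t) = ĝ(pξ,t) ĝ(qξ,t) - ĝ(ξ,t)`.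
As `ξ ∂_ξ ĝ = ∫ v Φ'(v) g(v) dv` for `Φ(v) = e^{-iξv}`, its weak form is
`d/dt ∫ Φ g + ½ (p² + q² - 1) ∫ v Φ' g = ∬ g(v) g(w) (Φ(v*) - Φ(v)) dw dv`.
The finite first moment gives a meaning to the drift term. -/
structure IsWeakSolution (p q : ℝ) (g₀ : ℝ → ℝ) (g : ℝ → ℝ → ℝ) : Prop where
  nonneg : ∀ t, 0 ≤ t → 0 ≤ᵐ[volume] g t
  integrable : ∀ t, 0 ≤ t → Integrable (g t)
  integrable_mul : ∀ t, 0 ≤ t → Integrable (fun v : ℝ => v * g t v)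
  initial : g 0 =ᵐ[volume] g₀
  tendsto_initial : ∀ Φ : ℝ → ℝ, IsTest Φ →
    Tendsto (fun t => ∫ v : ℝ, Φ v * g t v) (𝓝[>] 0) (𝓝 (∫ v : ℝ, Φ v * g₀ v))
  equation : ∀ Φ : ℝ → ℝ, IsTest Φ → ∀ t, 0 < t →
    HasDerivAt (fun s => ∫ v : ℝ, Φ v * g s v)
      (collision p q (g t) Φ
        - (1 / 2) * (p ^ 2 + q ^ 2 - 1) * ∫ v : ℝ, v * deriv Φ v * g t v) t

end MaxwellModel

end

/-!
Write `φ(ξ, t)` for the Fourier transform of the solution at time `t`, `c = ½ (p² + q² - 1) < 0`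
and `d = -c`. Along the characteristics `ξ' = c ξ` the equation reads
`φ' = φ(pξ) φ(qξ) - φ(ξ)`, and its right-hand side is monotone in the moduli of `φ(pξ)` and
`φ(qξ)`. A bound for `|φ|` therefore follows by comparison with any stationary supersolution
`exp (-κ e(|ξ|))`, that is, with any profile `e` such that

  `exp (κ (e(x) - e(px) - e(qx))) ≤ 1 + κ d x e'(x)`  for all `x > 0`.

With `e = x ^ θ` the linear part of this inequality is `S(θ - 2) ≥ 0`. It is strict for
`θ < 2`, an equality for `θ = 2`, and reversed for `2 < θ < 2 + δ'`. Hence `x ^ 2` has to be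
corrected to `x ^ 2 - z x ^ (2 + δ)`, with a margin `-z S(δ) x ^ (2 + δ)` that absorbs the quadratic error of
the exponential once `κ` is small. The weight `z` is chosen so that the logarithmic slope of this
function has dropped from `2` to `m = min ν λ` at `x = 1`, where it is continued by a multiple of
`x ^ m` (`profile`). As `e(x) / x ^ m` is nondecreasing, the linear margin at `x = 1` propagates to
all `x ≥ 1`; and as soon as `q x ≥ 1`, the left-hand exponent is nonpositive because
`p ^ m + q ^ m ≥ p ^ λ + q ^ λ = 1` (`exp_profile_defect_le`).

The initial density lies below `exp (-κ e)` for small `κ`: beyond `R` by the assumed decay, and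
inside `[-R, R]` by the doubling inequality `1 - |φ(2ξ)| ≤ 4 (1 - |φ(ξ)|)`, which turns a bound
away from `1` outside an interval into a Gaussian bound inside it
(`exists_norm_fourierTr_le_exp_profile`).

Differentiating `φ` along characteristics requires second moments of the weak solution that are
locally bounded in time; they come from Gronwall's inequality for bounded approximations of
`1 + v ^ 2` (`IsWeakSolution.second_moment`, `IsWeakSolution.hasDerivAt_characteristic`).
The comparison itself is an iteration: the excess of `|φ|` over the supersolution is at most `1`,
and each integration along characteristics improves a bound `(2t)^n / n!` on it to
`(2t)^(n+1) / (n+1)!` (`IsWeakSolution.comparison_step`).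
-/

namespace MaxwellModel

/-! ### The profile of the supersolution -/

/-- The weight `z` of the correction `x ^ (2 + δ)` in the profile, chosen so that
`2 - (2 + δ) z = m (1 - z)`: the logarithmic slope of `x ^ 2 - z x ^ (2 + δ)` at `x = 1` is `m`. -/
noncomputable def profileWeight (m δ : ℝ) : ℝ := (2 - m) / (2 - m + δ)

/-- The factor `y ^ (2 - m) - z y ^ (2 - m + δ)`; it increases on `[0, 1]`. -/
noncomputable def profileFactor (m δ y : ℝ) : ℝ :=
  y ^ (2 - m) - profileWeight m δ * y ^ (2 - m + δ)

/-- The profile `e(x)`, equal to `x ^ 2 - z x ^ (2 + δ)` for `0 ≤ x ≤ 1` and to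
`(1 - z) x ^ m` for `x ≥ 1`. The two branches meet with the same derivative. -/
noncomputable def profile (m δ x : ℝ) : ℝ := x ^ m * profileFactor m δ (min x 1)

/-- The function `x e'(x)` for the profile `e`. -/
noncomputable def profileSlope (m δ x : ℝ) : ℝ :=
  if x ≤ 1 then 2 * x ^ 2 - (2 + δ) * profileWeight m δ * x ^ (2 + δ)
  else m * (1 - profileWeight m δ) * x ^ m

section Profile

variable {m δ : ℝ}

lemma profileWeight_pos (hm2 : m < 2) (hδ : 0 < δ) : 0 < profileWeight m δ :=
  div_pos (by linarith) (by linarith)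

lemma profileWeight_lt_one (hm2 : m < 2) (hδ : 0 < δ) : profileWeight m δ < 1 := by
  rw [profileWeight, div_lt_one (by linarith)]; linarith

lemma profileWeight_slope (hm2 : m < 2) (hδ : 0 < δ) :
    2 - (2 + δ) * profileWeight m δ = m * (1 - profileWeight m δ) := by
  have : 2 - m + δ ≠ 0 := by linarith
  rw [profileWeight]; field_simp; ring

lemma profileFactor_zero (hm2 : m < 2) (hδ : 0 < δ) : profileFactor m δ 0 = 0 := by
  rw [profileFactor, Real.zero_rpow (by linarith), Real.zero_rpow (by linarith)]; simp

lemma profileFactor_one : profileFactor m δ 1 = 1 - profileWeight m δ := by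
  simp [profileFactor]

lemma profileFactor_monotoneOn (hm2 : m < 2) (hδ : 0 < δ) :
    MonotoneOn (profileFactor m δ) (Set.Icc 0 1) := by
  refine monotoneOn_of_hasDerivWithinAt_nonneg
    (f' := fun y => (2 - m) * y ^ (2 - m - 1) * (1 - y ^ δ)) (convex_Icc 0 1) ?_ ?_ ?_
  · refine ContinuousOn.sub ?_ (ContinuousOn.mul continuousOn_const ?_)
    · exact (Real.continuous_rpow_const (by linarith)).continuousOn
    · exact (Real.continuous_rpow_const (by linarith)).continuousOn
  · intro y hy
    rw [interior_Icc] at hy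
    have h1 := Real.hasDerivAt_rpow_const (x := y) (p := 2 - m) (Or.inl hy.1.ne')
    have h2 := Real.hasDerivAt_rpow_const (x := y) (p := 2 - m + δ) (Or.inl hy.1.ne')
    have h3 := (h1.sub (h2.const_mul (profileWeight m δ))).hasDerivWithinAt
      (s := interior (Set.Icc 0 1))
    refine h3.congr_deriv ?_
    have : 2 - m + δ ≠ 0 := by linarith
    rw [show 2 - m + δ - 1 = (2 - m - 1) + δ by ring, Real.rpow_add hy.1, profileWeight]
    field_simp
  · intro y hy
    rw [interior_Icc] at hy
    have h1 : y ^ δ ≤ 1 := Real.rpow_le_one hy.1.le hy.2.le hδ.le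
    have h2 : 0 ≤ y ^ (2 - m - 1) := Real.rpow_nonneg hy.1.le _
    have h3 : 0 ≤ 2 - m := by linarith
    have h4 : 0 ≤ 1 - y ^ δ := by linarith
    positivity

lemma profileFactor_nonneg (hm2 : m < 2) (hδ : 0 < δ) {y : ℝ} (hy0 : 0 ≤ y) (hy1 : y ≤ 1) :
    0 ≤ profileFactor m δ y := by
  rw [← profileFactor_zero hm2 hδ]
  exact profileFactor_monotoneOn hm2 hδ (by simp) ⟨hy0, hy1⟩ hy0

lemma profile_of_le_one {x : ℝ} (hx0 : 0 < x) (hx1 : x ≤ 1) :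
    profile m δ x = x ^ 2 - profileWeight m δ * x ^ (2 + δ) := by
  have h1 : x ^ m * x ^ (2 - m) = x ^ 2 := by
    rw [← Real.rpow_add hx0, ← Real.rpow_natCast]; congr 1; push_cast; ring
  have h2 : x ^ m * x ^ (2 - m + δ) = x ^ (2 + δ) := by
    rw [← Real.rpow_add hx0]; congr 1; ring
  rw [profile, profileFactor, min_eq_left hx1, ← h1, ← h2]; ring

lemma profile_of_one_le {x : ℝ} (hx1 : 1 ≤ x) :
    profile m δ x = (1 - profileWeight m δ) * x ^ m := by
  rw [profile, min_eq_right hx1, profileFactor_one, mul_comm]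

lemma profile_nonneg (hm2 : m < 2) (hδ : 0 < δ) {x : ℝ} (hx : 0 ≤ x) : 0 ≤ profile m δ x :=
  mul_nonneg (Real.rpow_nonneg hx _)
    (profileFactor_nonneg hm2 hδ (le_min hx zero_le_one) (min_le_right _ _))

lemma profile_zero (hm0 : 0 < m) : profile m δ 0 = 0 := by
  rw [profile, Real.zero_rpow hm0.ne', zero_mul]

lemma profile_le_rpow (hm2 : m < 2) (hδ : 0 < δ) {x : ℝ} (hx1 : 1 ≤ x) :
    profile m δ x ≤ x ^ m := by
  rw [profile_of_one_le hx1]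
  have h1 := profileWeight_pos hm2 hδ
  have h2 : 0 ≤ x ^ m := Real.rpow_nonneg (by linarith) _
  nlinarith

lemma profile_le_sq (hm0 : 0 < m) (hm2 : m < 2) (hδ : 0 < δ) {x : ℝ} (hx : 0 ≤ x) :
    profile m δ x ≤ x ^ 2 := by
  rcases hx.eq_or_lt with rfl | hx0
  · simp [profile_zero hm0]
  rcases le_total x 1 with hx1 | hx1
  · rw [profile_of_le_one hx0 hx1]
    have := mul_nonneg (profileWeight_pos hm2 hδ).le (Real.rpow_nonneg hx (2 + δ))
    linarith
  · refine (profile_le_rpow hm2 hδ hx1).trans ?_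
    rw [← Real.rpow_natCast]
    exact Real.rpow_le_rpow_of_exponent_le hx1 (by push_cast; linarith)

lemma sq_le_profile (hm0 : 0 < m) (hm2 : m < 2) (hδ : 0 < δ) {x : ℝ} (hx : 0 ≤ x)
    (hx1 : x ≤ 1) : (1 - profileWeight m δ) * x ^ 2 ≤ profile m δ x := by
  rcases hx.eq_or_lt with rfl | hx0
  · simp [profile_zero hm0]
  rw [profile_of_le_one hx0 hx1]
  have h : x ^ (2 + δ) ≤ x ^ 2 := by
    rw [← Real.rpow_natCast]
    exact Real.rpow_le_rpow_of_exponent_ge hx0 hx1 (by push_cast; linarith)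
  have := mul_le_mul_of_nonneg_left h (profileWeight_pos hm2 hδ).le
  linarith

/-- `e(y) / y ^ m` is nondecreasing. -/
lemma rpow_mul_profile_le (hm2 : m < 2) (hδ : 0 < δ) {x y : ℝ} (hx : 1 ≤ x) (hy : 0 ≤ y) :
    x ^ m * profile m δ y ≤ profile m δ (y * x) := by
  have hx0 : 0 ≤ x := by linarith
  rw [profile, profile, Real.mul_rpow hy hx0, ← mul_assoc, mul_comm (x ^ m)]
  refine mul_le_mul_of_nonneg_left ?_ (by positivity)
  have h : y ≤ y * x := by nlinarith
  exact profileFactor_monotoneOn hm2 hδ ⟨le_min hy zero_le_one, min_le_right _ _⟩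
    ⟨le_min (by positivity) zero_le_one, min_le_right _ _⟩ (min_le_min_right _ h)

lemma profile_hasDerivWithinAt {x : ℝ} (hx : 0 < x) :
    HasDerivWithinAt (profile m δ) (profileSlope m δ x / x) (Set.Iic x) x := by
  by_cases hx1 : x ≤ 1
  · have h1 : HasDerivAt (fun y : ℝ => y ^ 2 - profileWeight m δ * y ^ (2 + δ))
        (profileSlope m δ x / x) x := by
      have h2 := Real.hasDerivAt_rpow_const (x := x) (p := 2 + δ) (Or.inl hx.ne')
      refine ((hasDerivAt_pow 2 x).sub (h2.const_mul (profileWeight m δ))).congr_deriv ?_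
      rw [profileSlope, if_pos hx1, show 2 + δ - 1 = 1 + δ by ring,
        show (2 : ℝ) + δ = 1 + (1 + δ) by ring, Real.rpow_add hx 1 (1 + δ), Real.rpow_one]
      field_simp
      push_cast; ring
    refine h1.hasDerivWithinAt.congr_of_eventuallyEq ?_ (profile_of_le_one hx hx1)
    filter_upwards [self_mem_nhdsWithin, mem_nhdsWithin_of_mem_nhds (Ioi_mem_nhds hx)] with y hy hy0
    exact profile_of_le_one hy0 (le_trans hy hx1)
  · have h1 : HasDerivAt (fun y : ℝ => (1 - profileWeight m δ) * y ^ m)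
        (profileSlope m δ x / x) x := by
      have h2 := Real.hasDerivAt_rpow_const (x := x) (p := m) (Or.inl hx.ne')
      refine (h2.const_mul _).congr_deriv ?_
      rw [profileSlope, if_neg hx1, Real.rpow_sub hx, Real.rpow_one]
      field_simp
    push Not at hx1
    refine (h1.congr_of_eventuallyEq ?_).hasDerivWithinAt
    filter_upwards [Ioi_mem_nhds hx1] with y hy
    exact profile_of_one_le (le_of_lt hy)

end Profile

/-! ### The supersolution inequality -/

section Supersolution

variable {p q m δ : ℝ}

lemma profile_defect_of_le_one (x : ℝ) (hx : 0 < x) (hp : 0 < p) (hq : 0 < q) (hp1 : p < 1)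
    (hq1 : q < 1) (hx1 : x ≤ 1) :
    profile m δ x - profile m δ (p * x) - profile m δ (q * x)
      = (1 - p ^ 2 - q ^ 2) / 2 * profileSlope m δ x
        + profileWeight m δ * S p q δ * x ^ (2 + δ) := by
  rw [profile_of_le_one hx hx1, profile_of_le_one (mul_pos hp hx) (by nlinarith),
    profile_of_le_one (mul_pos hq hx) (by nlinarith), profileSlope, if_pos hx1, S,
    Real.mul_rpow hp.le hx.le, Real.mul_rpow hq.le hx.le]
  ring

/-- The defect of the profile, `e(x) - e(px) - e(qx)`, is dominated by the drift with a margin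
proportional to `-S`. The identity at `x = 1` propagates to `x > 1` because `e(y) / y ^ m` is
nondecreasing. -/
lemma profile_defect_le_of_one_le {x : ℝ} (hp : 0 < p) (hq : 0 < q) (hp1 : p < 1) (hq1 : q < 1)
    (hm2 : m < 2) (hδ : 0 < δ) (hx1 : 1 < x) :
    profile m δ x - profile m δ (p * x) - profile m δ (q * x)
      ≤ (1 - p ^ 2 - q ^ 2) / 2 * profileSlope m δ x
        + profileWeight m δ * S p q δ * x ^ m := by
  have h1 := profile_defect_of_le_one (m := m) (δ := δ) 1 one_pos hp hq hp1 hq1 le_rfl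
  have h2 := rpow_mul_profile_le hm2 hδ hx1.le hp.le
  have h3 := rpow_mul_profile_le hm2 hδ hx1.le hq.le
  have h4 := profileWeight_slope hm2 hδ
  rw [profileSlope, if_pos le_rfl, profile_of_one_le le_rfl] at h1
  simp only [Real.one_rpow, mul_one, one_pow] at h1
  rw [profile_of_one_le hx1.le, profileSlope, if_neg (not_le.2 hx1)]
  rw [h4] at h1
  have h5 := congrArg (fun y => x ^ m * y) h1
  linarith

lemma abs_profile_defect_le {x : ℝ} (hp : 0 < p) (hq : 0 < q) (hpq : p ^ 2 + q ^ 2 < 1)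
    (hm0 : 0 < m) (hm2 : m < 2) (hδ : 0 < δ) (hx : 0 < x) :
    |profile m δ x - profile m δ (p * x) - profile m δ (q * x)| ≤ x ^ 2 := by
  have a1 := profile_nonneg hm2 hδ hx.le
  have a2 := profile_nonneg hm2 hδ (mul_pos hp hx).le
  have a3 := profile_nonneg hm2 hδ (mul_pos hq hx).le
  have b1 := profile_le_sq hm0 hm2 hδ hx.le
  have b2 := profile_le_sq hm0 hm2 hδ (mul_pos hp hx).le
  have b3 := profile_le_sq hm0 hm2 hδ (mul_pos hq hx).le
  rw [abs_le]
  constructor <;> nlinarith [sq_nonneg x]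

/-- `exp (-κ e)` is a stationary supersolution of the scaled equation. -/
lemma exp_profile_defect_le {κ x : ℝ} (hp : 0 < p) (hq : 0 < q) (hqp : q ≤ p)
    (hpq : p ^ 2 + q ^ 2 < 1)
    (hm0 : 0 < m) (hm2 : m < 2) (hδ : 0 < δ) (hδ1 : δ < 1) (hm : 1 ≤ p ^ m + q ^ m)
    (hκ : 0 < κ) (hκ1 : κ ≤ q ^ 4) (hκS : κ ≤ profileWeight m δ * (-S p q δ) * q ^ 4)
    (hx : 0 < x) :
    Real.exp (κ * (profile m δ x - profile m δ (p * x) - profile m δ (q * x)))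
      ≤ 1 + κ * ((1 - p ^ 2 - q ^ 2) / 2 * profileSlope m δ x) := by
  have hp1 : p < 1 := by nlinarith
  have hq1 : q < 1 := by nlinarith
  have hX := abs_profile_defect_le hp hq hpq hm0 hm2 hδ hx
  have hz1 := profileWeight_lt_one hm2 hδ
  have hq4 : q ^ 4 ≤ 1 := pow_le_one₀ hq.le hq1.le
  have hT : 0 ≤ profileWeight m δ * (-S p q δ) := by
    by_contra! h
    have : 0 < q ^ 4 := by positivity
    nlinarith
  rcases le_or_gt x 1 with hx1 | hx1
  · have hid := profile_defect_of_le_one (m := m) (δ := δ) x hx hp hq hp1 hq1 hx1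
    set X := profile m δ x - profile m δ (p * x) - profile m δ (q * x)
    have hx2 : x ^ 2 ≤ 1 := pow_le_one₀ hx.le hx1
    have h1 : |κ * X| ≤ 1 := by
      rw [abs_mul, abs_of_pos hκ]; nlinarith [abs_nonneg X]
    have h2 := (abs_le.1 (Real.abs_exp_sub_one_sub_id_le h1)).2
    have h3 : X ^ 2 ≤ x ^ 4 := by
      have := pow_le_pow_left₀ (abs_nonneg X) hX 2
      rw [sq_abs] at this; linarith [show (x ^ 2) ^ 2 = x ^ 4 by ring]
    have h4 : x ^ 4 ≤ x ^ (2 + δ) := by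
      rw [← Real.rpow_natCast]
      exact Real.rpow_le_rpow_of_exponent_ge hx hx1 (by push_cast; linarith)
    have h5 : κ ≤ profileWeight m δ * (-S p q δ) := by nlinarith
    have h6 : κ * X ^ 2 ≤ profileWeight m δ * (-S p q δ) * x ^ (2 + δ) :=
      mul_le_mul h5 (h3.trans h4) (sq_nonneg _) hT
    have h7 := mul_le_mul_of_nonneg_left h6 hκ.le
    have h8 := congrArg (fun y => κ * y) hid
    nlinarith
  · rcases le_or_gt 1 (q * x) with hqx | hqx
    · have hpx : 1 ≤ p * x := hqx.trans (by gcongr)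
      rw [profile_of_one_le hx1.le, profile_of_one_le hpx, profile_of_one_le hqx, profileSlope,
        if_neg (not_le.2 hx1), Real.mul_rpow hp.le hx.le, Real.mul_rpow hq.le hx.le]
      have hxm : 0 ≤ x ^ m := Real.rpow_nonneg hx.le _
      have hY : 0 ≤ (1 - profileWeight m δ) * x ^ m := mul_nonneg (by linarith) hxm
      have h0 : 0 ≤ (1 - p ^ 2 - q ^ 2) / 2 := by linarith
      have h1 : 0 ≤ κ * ((1 - p ^ 2 - q ^ 2) / 2 * (m * (1 - profileWeight m δ) * x ^ m)) := by
        rw [mul_assoc m]; positivity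
      refine le_trans (Real.exp_le_one_iff.2 ?_) (by linarith)
      refine mul_nonpos_of_nonneg_of_nonpos hκ.le ?_
      nlinarith
    -- on `1 < x < 1 / q` the margin still controls the quadratic error, as `κ x ^ 4 ≤ κ / q ^ 4`
    · have hid := profile_defect_le_of_one_le (m := m) hp hq hp1 hq1 hm2 hδ hx1
      set X := profile m δ x - profile m δ (p * x) - profile m δ (q * x)
      have hqx4 : q ^ 4 * x ^ 4 ≤ 1 := by
        rw [← mul_pow]; exact pow_le_one₀ (by positivity) hqx.le
      have hx4 : x ^ 2 ≤ x ^ 4 := pow_le_pow_right₀ hx1.le (by norm_num)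
      have h1 : |κ * X| ≤ 1 := by
        rw [abs_mul, abs_of_pos hκ]
        calc κ * |X| ≤ q ^ 4 * x ^ 4 :=
              mul_le_mul hκ1 (hX.trans hx4) (abs_nonneg _) (by positivity)
          _ ≤ 1 := hqx4
      have h2 := (abs_le.1 (Real.abs_exp_sub_one_sub_id_le h1)).2
      have h3 : X ^ 2 ≤ x ^ 4 := by
        have := pow_le_pow_left₀ (abs_nonneg X) hX 2
        rw [sq_abs] at this; linarith [show (x ^ 2) ^ 2 = x ^ 4 by ring]
      have h4 : 1 ≤ x ^ m := Real.one_le_rpow hx1.le hm0.le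
      have h6 : κ * X ^ 2 ≤ profileWeight m δ * (-S p q δ) * x ^ m := by
        calc κ * X ^ 2 ≤ (profileWeight m δ * (-S p q δ) * q ^ 4) * x ^ 4 :=
              mul_le_mul hκS h3 (sq_nonneg _) (by positivity)
          _ = profileWeight m δ * (-S p q δ) * (q ^ 4 * x ^ 4) := by ring
          _ ≤ profileWeight m δ * (-S p q δ) * x ^ m := by
              gcongr; linarith
      have h7 := mul_le_mul_of_nonneg_left h6 hκ.le
      have h8 := mul_le_mul_of_nonneg_left hid hκ.le
      nlinarith

end Supersolution

/-! ### Fourier transforms of probability densities -/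

section Fourier

variable {h : ℝ → ℝ}

lemma norm_exp_neg_ofReal_mul_I (x : ℝ) : ‖Complex.exp (-(x : ℂ) * Complex.I)‖ = 1 := by
  rw [← Complex.ofReal_neg, Complex.norm_exp_ofReal_mul_I]

/-- A bounded continuous function times an integrable one is integrable. -/
lemma integrable_bounded_mul {Φ : ℝ → ℝ} (hΦ : Continuous Φ) {C : ℝ} (hC : ∀ v, |Φ v| ≤ C)
    (hi : Integrable h) : Integrable (fun v => Φ v * h v) :=
  hi.bdd_mul (c := C) hΦ.aestronglyMeasurable (.of_forall fun v => by simpa using hC v)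

lemma integrable_fourier (hi : Integrable h) (ξ : ℝ) :
    Integrable (fun v : ℝ => Complex.exp (-((ξ * v : ℝ) : ℂ) * Complex.I) * (h v : ℂ)) :=
  hi.ofReal.bdd_mul (c := 1) (by fun_prop)
    (.of_forall fun v => (norm_exp_neg_ofReal_mul_I _).le)

lemma integrable_cos_mul (hi : Integrable h) (ξ θ : ℝ) :
    Integrable (fun v : ℝ => Real.cos (ξ * v + θ) * h v) :=
  integrable_bounded_mul (by fun_prop) (fun v => Real.abs_cos_le_one _) hi

lemma integrable_sin_mul (hi : Integrable h) (ξ θ : ℝ) :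
    Integrable (fun v : ℝ => Real.sin (ξ * v + θ) * h v) :=
  integrable_bounded_mul (by fun_prop) (fun v => Real.abs_sin_le_one _) hi

lemma norm_fourierTr_le (hn : 0 ≤ᵐ[volume] h) (ξ : ℝ) : ‖fourierTr h ξ‖ ≤ ∫ v, h v := by
  refine (norm_integral_le_integral_norm _).trans (le_of_eq (integral_congr_ae ?_))
  filter_upwards [hn] with v hv
  rw [norm_mul, norm_exp_neg_ofReal_mul_I, one_mul, Complex.norm_real, Real.norm_of_nonneg hv]

/-- The phase-shifted real part of the Fourier transform. -/
lemma re_fourierTr_mul (hi : Integrable h) (ξ θ : ℝ) :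
    (Complex.exp (-(θ : ℂ) * Complex.I) * fourierTr h ξ).re
      = ∫ v, Real.cos (ξ * v + θ) * h v := by
  rw [fourierTr, ← integral_const_mul]
  have := integral_re ((integrable_fourier hi ξ).const_mul (Complex.exp (-(θ : ℂ) * Complex.I)))
  simp only [RCLike.re_eq_complex_re] at this
  rw [← this]
  congr 1; ext v
  rw [← mul_assoc, ← Complex.exp_add, Complex.re_mul_ofReal,
    show -(θ : ℂ) * Complex.I + -((ξ * v : ℝ) : ℂ) * Complex.I
      = ((-(ξ * v + θ) : ℝ) : ℂ) * Complex.I by push_cast; ring,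
    Complex.exp_ofReal_mul_I_re, Real.cos_neg]

lemma im_fourierTr_mul (hi : Integrable h) (ξ θ : ℝ) :
    (Complex.exp (-(θ : ℂ) * Complex.I) * fourierTr h ξ).im
      = -∫ v, Real.sin (ξ * v + θ) * h v := by
  rw [fourierTr, ← integral_const_mul, ← integral_neg]
  have := integral_im ((integrable_fourier hi ξ).const_mul (Complex.exp (-(θ : ℂ) * Complex.I)))
  simp only [RCLike.im_eq_complex_im] at this
  rw [← this]
  congr 1; ext v
  rw [← mul_assoc, ← Complex.exp_add, Complex.im_mul_ofReal,
    show -(θ : ℂ) * Complex.I + -((ξ * v : ℝ) : ℂ) * Complex.I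
      = ((-(ξ * v + θ) : ℝ) : ℂ) * Complex.I by push_cast; ring,
    Complex.exp_ofReal_mul_I_im, Real.sin_neg, neg_mul]

lemma exists_re_fourierTr_eq_norm (ξ : ℝ) :
    ∃ θ : ℝ, (Complex.exp (-(θ : ℂ) * Complex.I) * fourierTr h ξ).re = ‖fourierTr h ξ‖ := by
  refine ⟨Complex.arg (fourierTr h ξ), ?_⟩
  conv_lhs => rw [← Complex.norm_mul_exp_arg_mul_I (fourierTr h ξ)]
  rw [mul_left_comm, ← Complex.exp_add]
  simp

/-- The doubling inequality `1 - |ĥ(2ξ)| ≤ 4 (1 - |ĥ(ξ)|)` for probability densities, from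
`cos 2x = 2 cos² x - 1` and Jensen's inequality. -/
lemma one_sub_norm_fourierTr_two_mul_le (hn : 0 ≤ᵐ[volume] h) (hi : Integrable h)
    (h1 : ∫ v, h v = 1) (ξ : ℝ) :
    1 - ‖fourierTr h (2 * ξ)‖ ≤ 4 * (1 - ‖fourierTr h ξ‖) := by
  obtain ⟨θ, hθ⟩ := exists_re_fourierTr_eq_norm (h := h) ξ
  set a := ‖fourierTr h ξ‖
  have ha1 : a ≤ 1 := h1 ▸ norm_fourierTr_le hn ξ
  rw [re_fourierTr_mul hi] at hθ
  have hdouble : (Complex.exp (-((2 * θ : ℝ) : ℂ) * Complex.I) * fourierTr h (2 * ξ)).re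
      ≤ ‖fourierTr h (2 * ξ)‖ := by
    refine (Complex.re_le_norm _).trans ?_
    rw [norm_mul, norm_exp_neg_ofReal_mul_I, one_mul]
  rw [re_fourierTr_mul hi] at hdouble
  -- the tangent to `2 c ^ 2 - 1` at `c = a`
  have hlow : ∫ v, (4 * a * (Real.cos (ξ * v + θ) * h v) - (2 * a ^ 2 + 1) * h v)
      ≤ ∫ v, Real.cos (2 * ξ * v + 2 * θ) * h v := by
    refine integral_mono_ae (((integrable_cos_mul hi ξ θ).const_mul _).sub (hi.const_mul _))
      (integrable_cos_mul hi _ _) ?_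
    filter_upwards [hn] with v hv
    have hv' : 0 ≤ h v := hv
    have : Real.cos (2 * ξ * v + 2 * θ) = 2 * Real.cos (ξ * v + θ) ^ 2 - 1 := by
      rw [← Real.cos_two_mul]; congr 1; ring
    simp only [this]
    nlinarith [mul_nonneg hv' (sq_nonneg (Real.cos (ξ * v + θ) - a))]
  rw [integral_sub ((integrable_cos_mul hi ξ θ).const_mul _) (hi.const_mul _),
    integral_const_mul, integral_const_mul, hθ, h1] at hlow
  nlinarith [norm_nonneg (fourierTr h ξ)]

lemma one_sub_norm_fourierTr_two_pow_mul_le (hn : 0 ≤ᵐ[volume] h) (hi : Integrable h)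
    (h1 : ∫ v, h v = 1) (ξ : ℝ) (n : ℕ) :
    1 - ‖fourierTr h (2 ^ n * ξ)‖ ≤ 4 ^ n * (1 - ‖fourierTr h ξ‖) := by
  induction n with
  | zero => simp
  | succ k ih =>
    have := one_sub_norm_fourierTr_two_mul_le hn hi h1 (2 ^ k * ξ)
    rw [pow_succ' 2, mul_assoc, pow_succ' 4]
    linarith

/-- A bound `|ĥ| ≤ 1 - ε` beyond `R` yields a Gaussian bound inside `[-R, R]`, by doubling
`ξ` until it leaves the interval. -/
lemma exists_norm_fourierTr_le_exp_sq (hn : 0 ≤ᵐ[volume] h) (hi : Integrable h)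
    (h1 : ∫ v, h v = 1) {R ε : ℝ} (hR : 0 < R) (hε : 0 < ε)
    (hout : ∀ ξ : ℝ, R < |ξ| → ‖fourierTr h ξ‖ ≤ 1 - ε) :
    ∃ c : ℝ, 0 < c ∧ ∀ ξ : ℝ, |ξ| ≤ R → ‖fourierTr h ξ‖ ≤ Real.exp (-c * ξ ^ 2) := by
  refine ⟨ε / (4 * R ^ 2), by positivity, fun ξ hξ => ?_⟩
  rcases eq_or_ne ξ 0 with rfl | hξ0
  · simpa [h1] using norm_fourierTr_le hn 0
  have hpos : 0 < |ξ| := abs_pos.2 hξ0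
  obtain ⟨n, hn1, hn2⟩ := exists_nat_pow_near (x := R / |ξ|) (y := (2 : ℝ))
    ((one_le_div hpos).2 hξ) one_lt_two
  rw [le_div_iff₀ hpos] at hn1
  rw [div_lt_iff₀ hpos] at hn2
  have hd := one_sub_norm_fourierTr_two_pow_mul_le hn hi h1 ξ (n + 1)
  have ho := hout (2 ^ (n + 1) * ξ) (by rwa [abs_mul, abs_of_pos (by positivity)])
  have hsq : (4 : ℝ) ^ (n + 1) * ξ ^ 2 ≤ 4 * R ^ 2 := by
    have : (2 ^ n * |ξ|) ^ 2 ≤ R ^ 2 := pow_le_pow_left₀ (by positivity) hn1 2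
    rw [mul_pow, sq_abs, ← pow_mul, mul_comm n, pow_mul] at this
    norm_num at this
    rw [pow_succ]; linarith
  have h4 : (0 : ℝ) < 4 ^ (n + 1) := by positivity
  have hkey : ε / (4 * R ^ 2) * ξ ^ 2 ≤ 1 - ‖fourierTr h ξ‖ := by
    rw [div_mul_eq_mul_div, div_le_iff₀ (by positivity)]
    have h5 : ε ≤ 4 ^ (n + 1) * (1 - ‖fourierTr h ξ‖) := by linarith
    have h6 : 0 ≤ 1 - ‖fourierTr h ξ‖ := by
      have := norm_fourierTr_le hn ξ; linarith
    calc ε * ξ ^ 2 ≤ 4 ^ (n + 1) * (1 - ‖fourierTr h ξ‖) * ξ ^ 2 := by gcongr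
      _ = (1 - ‖fourierTr h ξ‖) * (4 ^ (n + 1) * ξ ^ 2) := by ring
      _ ≤ (1 - ‖fourierTr h ξ‖) * (4 * R ^ 2) := by gcongr
  have := Real.add_one_le_exp (-(ε / (4 * R ^ 2)) * ξ ^ 2)
  linarith

/-- A density whose Fourier transform decays like `exp (-β |ξ| ^ ν)` lies below the
supersolution `exp (-κ e)` for all small `κ`. -/
lemma exists_norm_fourierTr_le_exp_profile (hn : 0 ≤ᵐ[volume] h) (hi : Integrable h)
    (h1 : ∫ v, h v = 1) {R ν β m δ : ℝ} (hR : 0 < R) (hν : 0 < ν) (hβ : 0 < β)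
    (hdecay : ∀ ξ : ℝ, R < |ξ| → ‖fourierTr h ξ‖ ≤ Real.exp (-β * |ξ| ^ ν))
    (hm0 : 0 < m) (hm2 : m < 2) (hδ : 0 < δ) (hmν : m ≤ ν) :
    ∃ c : ℝ, 0 < c ∧ ∀ κ : ℝ, 0 < κ → κ ≤ c → ∀ ξ : ℝ,
      ‖fourierTr h ξ‖ ≤ Real.exp (-κ * profile m δ |ξ|) := by
  have hR' : 0 < max R 1 := by positivity
  have hε : 0 < 1 - Real.exp (-β) := by simpa using hβ
  have hout : ∀ ξ : ℝ, max R 1 < |ξ| → ‖fourierTr h ξ‖ ≤ 1 - (1 - Real.exp (-β)) := by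
    intro ξ hξ
    refine (hdecay ξ ((le_max_left _ _).trans_lt hξ)).trans ?_
    rw [sub_sub_cancel, Real.exp_le_exp]
    have : 1 ≤ |ξ| ^ ν := Real.one_le_rpow ((le_max_right _ _).trans hξ.le) hν.le
    nlinarith
  obtain ⟨c, hc, hin⟩ := exists_norm_fourierTr_le_exp_sq hn hi h1 hR' hε hout
  refine ⟨min c β, lt_min hc hβ, fun κ hκ hκc ξ => ?_⟩
  rcases le_or_gt |ξ| (max R 1) with hξ | hξ
  · refine (hin ξ hξ).trans (Real.exp_le_exp.2 ?_)
    have e1 := profile_le_sq hm0 hm2 hδ (abs_nonneg ξ)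
    rw [sq_abs] at e1
    have := mul_le_mul (hκc.trans (min_le_left _ _)) e1 (profile_nonneg hm2 hδ (abs_nonneg ξ))
      hc.le
    linarith
  · refine (hdecay ξ ((le_max_left _ _).trans_lt hξ)).trans (Real.exp_le_exp.2 ?_)
    have hξ1 : 1 ≤ |ξ| := (le_max_right _ _).trans hξ.le
    have e1 := (profile_le_rpow hm2 hδ hξ1).trans (Real.rpow_le_rpow_of_exponent_le hξ1 hmν)
    have := mul_le_mul (hκc.trans (min_le_right _ _)) e1 (profile_nonneg hm2 hδ (abs_nonneg ξ))
      hβ.le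
    linarith

/-! ### Regularity in the frequency -/

/-- The derivative `ĥ'(ξ) = ∫ (-iv) e^{-iξv} h(v) dv` of the Fourier transform. -/
noncomputable def fourierDeriv (h : ℝ → ℝ) (ξ : ℝ) : ℂ :=
  ∫ v : ℝ, (-(v : ℂ) * Complex.I) * Complex.exp (-((ξ * v : ℝ) : ℂ) * Complex.I) * (h v : ℂ)

lemma integrable_fourierDeriv (hi1 : Integrable (fun v : ℝ => v * h v)) (ξ : ℝ) :
    Integrable (fun v : ℝ => (-(v : ℂ) * Complex.I)
      * Complex.exp (-((ξ * v : ℝ) : ℂ) * Complex.I) * (h v : ℂ)) := by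
  have := (hi1.ofReal (𝕜 := ℂ)).bdd_mul (c := 1)
    (f := fun v : ℝ => -Complex.I * Complex.exp (-((ξ * v : ℝ) : ℂ) * Complex.I))
    (by fun_prop) (.of_forall fun v => by
      rw [norm_mul, norm_exp_neg_ofReal_mul_I]; simp)
  refine this.congr (.of_forall fun v => ?_)
  simp; ring

lemma re_fourierDeriv_mul (hi1 : Integrable (fun v : ℝ => v * h v)) (ξ θ : ℝ) :
    (Complex.exp (-(θ : ℂ) * Complex.I) * fourierDeriv h ξ).re
      = ∫ v, v * -Real.sin (ξ * v + θ) * h v := by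
  rw [fourierDeriv, ← integral_const_mul]
  have := integral_re ((integrable_fourierDeriv hi1 ξ).const_mul
    (Complex.exp (-(θ : ℂ) * Complex.I)))
  simp only [RCLike.re_eq_complex_re] at this
  rw [← this]
  congr 1; ext v
  rw [← mul_assoc, mul_left_comm, ← Complex.exp_add, Complex.re_mul_ofReal,
    show -(θ : ℂ) * Complex.I + -((ξ * v : ℝ) : ℂ) * Complex.I
      = ((-(ξ * v + θ) : ℝ) : ℂ) * Complex.I by push_cast; ring, Complex.mul_re,
    Complex.exp_ofReal_mul_I_im, Real.sin_neg]
  simp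

lemma hasDerivAt_fourierTr (hi : Integrable h) (hi1 : Integrable (fun v : ℝ => v * h v)) (ξ : ℝ) :
    HasDerivAt (fourierTr h) (fourierDeriv h ξ) ξ := by
  refine (hasDerivAt_integral_of_dominated_loc_of_deriv_le (μ := volume)
    (F := fun ξ v => Complex.exp (-((ξ * v : ℝ) : ℂ) * Complex.I) * (h v : ℂ))
    (F' := fun ξ v => (-(v : ℂ) * Complex.I) * Complex.exp (-((ξ * v : ℝ) : ℂ) * Complex.I)
      * (h v : ℂ)) (bound := fun v => |v * h v|) (s := Set.univ) (x₀ := ξ)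
    Filter.univ_mem ?_ (integrable_fourier hi ξ) ?_ ?_ hi1.abs ?_).2
  · exact .of_forall fun x => (integrable_fourier hi x).aestronglyMeasurable
  · exact AEStronglyMeasurable.mul (by fun_prop) hi.ofReal.aestronglyMeasurable
  · refine .of_forall fun v x _ => ?_
    rw [norm_mul, norm_mul, norm_exp_neg_ofReal_mul_I, mul_one, norm_mul, Complex.norm_I, mul_one,
      norm_neg, Complex.norm_real, Complex.norm_real, abs_mul]
    rfl
  · refine .of_forall fun v x _ => ?_
    have h1 : HasDerivAt (fun x : ℝ => -((x * v : ℝ) : ℂ) * Complex.I)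
        (-(v : ℂ) * Complex.I) x := by
      have := ((hasDerivAt_id x).mul_const v).ofReal_comp.neg.mul_const Complex.I
      simpa using this
    refine (h1.cexp.mul_const (h v : ℂ)).congr_deriv ?_
    ring

lemma integrable_one_add_sq_mul (hi : Integrable h)
    (hi2 : Integrable (fun v : ℝ => v ^ 2 * h v)) :
    Integrable (fun v : ℝ => (1 + v ^ 2) * h v) :=
  (hi.add hi2).congr (.of_forall fun v => by simp only [Pi.add_apply]; ring)

lemma norm_fourierDeriv_le (hn : 0 ≤ᵐ[volume] h) (hi : Integrable h)
    (hi2 : Integrable (fun v : ℝ => v ^ 2 * h v)) (ξ : ℝ) :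
    ‖fourierDeriv h ξ‖ ≤ ∫ v, (1 + v ^ 2) * h v := by
  refine norm_integral_le_of_norm_le (integrable_one_add_sq_mul hi hi2) ?_
  filter_upwards [hn] with v hv
  have hv' : 0 ≤ h v := hv
  rw [norm_mul, norm_mul, norm_exp_neg_ofReal_mul_I, mul_one, norm_mul, Complex.norm_I, mul_one,
      norm_neg, Complex.norm_real, Complex.norm_real, Real.norm_of_nonneg hv', Real.norm_eq_abs]
  gcongr
  nlinarith [sq_abs v, sq_nonneg (|v| - 1)]

lemma norm_fourierDeriv_sub_le (hn : 0 ≤ᵐ[volume] h) (hi : Integrable h)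
    (hi1 : Integrable (fun v : ℝ => v * h v))
    (hi2 : Integrable (fun v : ℝ => v ^ 2 * h v)) (ξ η : ℝ) :
    ‖fourierDeriv h ξ - fourierDeriv h η‖ ≤ (∫ v, (1 + v ^ 2) * h v) * |ξ - η| := by
  rw [fourierDeriv, fourierDeriv, ← integral_sub (integrable_fourierDeriv hi1 ξ)
    (integrable_fourierDeriv hi1 η), ← integral_mul_const]
  refine norm_integral_le_of_norm_le ((integrable_one_add_sq_mul hi hi2).mul_const _) ?_
  filter_upwards [hn] with v hv
  have hv' : 0 ≤ h v := hv
  have hexp : ‖Complex.exp (-((ξ * v : ℝ) : ℂ) * Complex.I)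
      - Complex.exp (-((η * v : ℝ) : ℂ) * Complex.I)‖ ≤ |ξ - η| * |v| := by
    have e : Complex.exp (-((ξ * v : ℝ) : ℂ) * Complex.I)
      - Complex.exp (-((η * v : ℝ) : ℂ) * Complex.I)
      = Complex.exp (-((η * v : ℝ) : ℂ) * Complex.I)
        * (Complex.exp (Complex.I * ((-(ξ - η) * v : ℝ) : ℂ)) - 1) := by
      rw [mul_sub, ← Complex.exp_add, mul_one]
      congr 2; push_cast; ring
    rw [e, norm_mul, norm_exp_neg_ofReal_mul_I, one_mul]
    refine (Real.norm_exp_I_mul_ofReal_sub_one_le).trans ?_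
    rw [Real.norm_eq_abs, abs_mul, abs_neg]
  rw [← sub_mul, ← mul_sub, norm_mul, norm_mul, norm_mul, Complex.norm_I, mul_one,
      norm_neg, Complex.norm_real, Complex.norm_real, Real.norm_of_nonneg hv', Real.norm_eq_abs]
  calc |v| * _ * h v ≤ |v| * (|ξ - η| * |v|) * h v := by gcongr
    _ = v ^ 2 * h v * |ξ - η| := by rw [← sq_abs v]; ring
    _ ≤ (1 + v ^ 2) * h v * |ξ - η| := by gcongr; linarith

lemma norm_fourierTr_sub_le (hn : 0 ≤ᵐ[volume] h) (hi : Integrable h)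
    (hi1 : Integrable (fun v : ℝ => v * h v))
    (hi2 : Integrable (fun v : ℝ => v ^ 2 * h v)) (ξ η : ℝ) :
    ‖fourierTr h ξ - fourierTr h η‖ ≤ (∫ v, (1 + v ^ 2) * h v) * |ξ - η| := by
  have := (convex_univ (𝕜 := ℝ) (E := ℝ)).norm_image_sub_le_of_norm_hasDerivWithin_le
    (f := fourierTr h) (f' := fourierDeriv h) (C := ∫ v, (1 + v ^ 2) * h v) (x := η) (y := ξ)
    (fun x _ => (hasDerivAt_fourierTr hi hi1 x).hasDerivWithinAt)
    (fun x _ => norm_fourierDeriv_le hn hi hi2 x) trivial trivial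
  simpa using this

end Fourier

/-! ### Mass and second moment of weak solutions -/

section Moments

lemma isTest_const (c : ℝ) : IsTest (fun _ => c) :=
  ⟨contDiff_const, ⟨|c|, fun _ => le_rfl⟩, ⟨0, fun _ => by simp⟩⟩

lemma isTest_cos (ξ θ : ℝ) : IsTest (fun v => Real.cos (ξ * v + θ)) := by
  refine ⟨by fun_prop, ⟨1, fun v => Real.abs_cos_le_one _⟩, ⟨|ξ|, fun v => ?_⟩⟩
  have h : HasDerivAt (fun v => Real.cos (ξ * v + θ)) (-Real.sin (ξ * v + θ) * ξ) v := by
    have := (((hasDerivAt_id v).const_mul ξ).add_const θ).cos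
    simpa using this
  rw [h.deriv, abs_mul, abs_neg]
  exact mul_le_of_le_one_left (abs_nonneg _) (Real.abs_sin_le_one _)

/-- A function on `(0, ∞)` with nonpositive derivative stays below its limit at `0⁺`. -/
lemma le_of_tendsto_of_hasDerivAt_nonpos {f f' : ℝ → ℝ} {a : ℝ}
    (hf : ∀ t, 0 < t → HasDerivAt f (f' t) t) (hf' : ∀ t, 0 < t → f' t ≤ 0)
    (ha : Tendsto f (𝓝[>] 0) (𝓝 a)) {t : ℝ} (ht : 0 < t) : f t ≤ a := by
  have hanti : AntitoneOn f (Set.Ioi 0) := by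
    refine antitoneOn_of_hasDerivWithinAt_nonpos (f' := f') (convex_Ioi 0)
      (fun s hs => (hf s hs).continuousAt.continuousWithinAt) ?_ ?_
    · intro s hs
      rw [interior_Ioi] at hs
      exact (hf s hs).hasDerivWithinAt
    · intro s hs
      rw [interior_Ioi] at hs
      exact hf' s hs
  refine ge_of_tendsto ha ?_
  filter_upwards [Ioo_mem_nhdsGT ht] with s hs
  exact hanti hs.1 ht hs.2.le

/-- A bounded test function that increases to `1 + v ^ 2` as `ε → 0`. -/
noncomputable def cutoff (ε v : ℝ) : ℝ := (1 + v ^ 2) / (1 + ε * (1 + v ^ 2))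

lemma cutoff_nonneg {ε : ℝ} (hε : 0 ≤ ε) (v : ℝ) : 0 ≤ cutoff ε v := by
  unfold cutoff; positivity

lemma cutoff_le {ε : ℝ} (hε : 0 ≤ ε) (v : ℝ) : cutoff ε v ≤ 1 + v ^ 2 :=
  div_le_self (by positivity) (by nlinarith [mul_nonneg hε (by positivity : 0 ≤ 1 + v ^ 2)])

lemma cutoff_le_inv {ε : ℝ} (hε : 0 < ε) (v : ℝ) : cutoff ε v ≤ 1 / ε := by
  rw [cutoff, div_le_div_iff₀ (by positivity) hε]; linarith

lemma continuous_cutoff {ε : ℝ} (hε : 0 ≤ ε) : Continuous (cutoff ε) := by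
  unfold cutoff
  exact Continuous.div (by fun_prop) (by fun_prop) (fun v => by positivity)

lemma hasDerivAt_cutoff {ε : ℝ} (hε : 0 ≤ ε) (v : ℝ) :
    HasDerivAt (cutoff ε) (2 * v / (1 + ε * (1 + v ^ 2)) ^ 2) v := by
  have h1 : HasDerivAt (fun v : ℝ => 1 + v ^ 2) (2 * v) v := by
    simpa using (hasDerivAt_pow 2 v).const_add 1
  refine (h1.div ((h1.const_mul ε).const_add 1) (by positivity)).congr_deriv ?_
  congr 1; ring

lemma mul_deriv_cutoff_nonneg {ε : ℝ} (hε : 0 ≤ ε) (v : ℝ) : 0 ≤ v * deriv (cutoff ε) v := by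
  rw [(hasDerivAt_cutoff hε v).deriv, ← mul_div_assoc,
    show v * (2 * v) = 2 * v ^ 2 by ring]
  positivity

lemma mul_deriv_cutoff_le {ε : ℝ} (hε : 0 ≤ ε) (v : ℝ) :
    v * deriv (cutoff ε) v ≤ 2 * cutoff ε v := by
  rw [(hasDerivAt_cutoff hε v).deriv, cutoff, ← mul_div_assoc, ← mul_div_assoc]
  have h : 1 ≤ 1 + ε * (1 + v ^ 2) := by
    nlinarith [mul_nonneg hε (by positivity : 0 ≤ 1 + v ^ 2)]
  exact div_le_div₀ (by positivity) (by nlinarith) (by positivity) (by nlinarith)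

lemma isTest_cutoff {ε : ℝ} (hε : 0 < ε) : IsTest (cutoff ε) := by
  refine ⟨?_, ⟨1 / ε, fun v => ?_⟩, ⟨1 / ε, fun v => ?_⟩⟩
  · unfold cutoff
    exact ContDiff.div (by fun_prop) (by fun_prop) (fun v => by positivity)
  · rw [abs_of_nonneg (cutoff_nonneg hε.le v)]
    exact cutoff_le_inv hε v
  · rw [(hasDerivAt_cutoff hε.le v).deriv, abs_div,
      abs_of_pos (by positivity : 0 < (1 + ε * (1 + v ^ 2)) ^ 2),
      div_le_div_iff₀ (by positivity) hε]
    have h1 : |2 * v| ≤ 1 + v ^ 2 := by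
      rw [abs_le]; constructor <;> nlinarith [sq_nonneg (v + 1), sq_nonneg (v - 1)]
    have h2 : 1 ≤ 1 + ε * (1 + v ^ 2) := by
      nlinarith [mul_nonneg hε.le (by positivity : 0 ≤ 1 + v ^ 2)]
    nlinarith

/-- The cutoff is subadditive along collisions, since `u / (1 + ε u)` is increasing and
subadditive on `[0, ∞)`. -/
lemma cutoff_collision_le {p q ε : ℝ} (hpq : p ^ 2 + q ^ 2 < 1) (hε : 0 ≤ ε) (v w : ℝ) :
    cutoff ε (p * v + q * w) ≤ cutoff ε v + cutoff ε w := by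
  unfold cutoff
  set a := 1 + v ^ 2 with ha
  set b := 1 + w ^ 2 with hb
  have ha0 : 0 < a := by positivity
  have hb0 : 0 < b := by positivity
  have hle : 1 + (p * v + q * w) ^ 2 ≤ a + b := by
    have : (p * v + q * w) ^ 2 ≤ (p ^ 2 + q ^ 2) * (v ^ 2 + w ^ 2) := by
      nlinarith [sq_nonneg (p * w - q * v)]
    nlinarith [sq_nonneg v, sq_nonneg w]
  have h1 : (1 + (p * v + q * w) ^ 2) / (1 + ε * (1 + (p * v + q * w) ^ 2))
      ≤ (a + b) / (1 + ε * (a + b)) := by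
    rw [div_le_div_iff₀ (by positivity) (by positivity)]
    nlinarith
  refine h1.trans ?_
  rw [add_div]
  gcongr <;> linarith

variable {p q : ℝ} {g₀ : ℝ → ℝ} {g : ℝ → ℝ → ℝ}

lemma IsWeakSolution.integral_eq_one (hg : IsWeakSolution p q g₀ g) (hg₀ : Normalized g₀)
    {t : ℝ} (ht : 0 ≤ t) : ∫ v, g t v = 1 := by
  rcases ht.eq_or_lt with rfl | ht
  · rw [integral_congr_ae hg.initial, hg₀.mass]
  have h0 := hg.tendsto_initial _ (isTest_const 1)
  have hd : ∀ s, 0 < s → HasDerivAt (fun s => ∫ v : ℝ, 1 * g s v) 0 s := fun s hs => by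
    simpa [collision] using hg.equation _ (isTest_const 1) s hs
  have h1 := le_of_tendsto_of_hasDerivAt_nonpos hd (fun _ _ => le_rfl) h0 ht
  have h2 := le_of_tendsto_of_hasDerivAt_nonpos (fun s hs => (hd s hs).neg)
    (fun _ _ => by simp) h0.neg ht
  simp only [one_mul, hg₀.mass] at h1 h2
  simp at h2
  linarith

/-- The gain at `v* = pv + qw` is at most the value at `v`, which the loss cancels, plus the value
at `w`. -/
lemma collision_cutoff_le {h : ℝ → ℝ} (hn : 0 ≤ᵐ[volume] h) (hi : Integrable h)
    (h1 : ∫ v, h v = 1) (hpq : p ^ 2 + q ^ 2 < 1) {ε : ℝ} (hε : 0 < ε) :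
    collision p q h (cutoff ε) ≤ ∫ v, cutoff ε v * h v := by
  have hb : ∀ v, |cutoff ε v| ≤ 1 / ε := fun v => by
    rw [abs_of_nonneg (cutoff_nonneg hε.le v)]; exact cutoff_le_inv hε v
  have hiΦ := integrable_bounded_mul (continuous_cutoff hε.le) hb hi
  set G := ∫ v, cutoff ε v * h v with hG
  have hG0 : 0 ≤ G := by
    refine integral_nonneg_of_ae ?_
    filter_upwards [hn] with v hv
    exact mul_nonneg (cutoff_nonneg hε.le v) hv
  have hinner : ∀ᵐ v, ∫ w, h v * h w * (cutoff ε (p * v + q * w) - cutoff ε v) ≤ h v * G := by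
    filter_upwards [hn] with v hv
    have hv' : 0 ≤ h v := hv
    rw [hG, ← integral_const_mul]
    refine integral_mono_ae ?_ (hiΦ.const_mul _) ?_
    · have hc : Continuous fun w => cutoff ε (p * v + q * w) - cutoff ε v :=
        ((continuous_cutoff hε.le).comp (by fun_prop)).sub continuous_const
      refine ((integrable_bounded_mul hc (C := 1 / ε + 1 / ε) (fun w => ?_) hi).const_mul
        (h v)).congr (.of_forall fun w => by simp only; ring)
      exact (abs_sub _ _).trans (add_le_add (hb _) (hb _))
    · filter_upwards [hn] with w hw
      have hw' : 0 ≤ h w := hw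
      have := cutoff_collision_le hpq hε.le v w
      calc h v * h w * (cutoff ε (p * v + q * w) - cutoff ε v) ≤ h v * h w * cutoff ε w := by
            gcongr; linarith
        _ = h v * (cutoff ε w * h w) := by ring
  have hbound : ∫ v, h v * G = G := by rw [integral_mul_const, h1, one_mul]
  rw [collision]
  -- if the outer integrand were not integrable, its integral would be `0 ≤ G` by convention
  by_cases hint : Integrable fun v => ∫ w, h v * h w * (cutoff ε (p * v + q * w) - cutoff ε v)
  · exact (integral_mono_ae hint (hi.mul_const _) hinner).trans hbound.le
  · rw [integral_undef hint]; exact hG0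

lemma drift_cutoff_le {h : ℝ → ℝ} (hn : 0 ≤ᵐ[volume] h) (hi : Integrable h) {ε : ℝ} (hε : 0 < ε) :
    ∫ v, v * deriv (cutoff ε) v * h v ≤ 2 * ∫ v, cutoff ε v * h v := by
  have hb : ∀ v, |cutoff ε v| ≤ 1 / ε := fun v => by
    rw [abs_of_nonneg (cutoff_nonneg hε.le v)]; exact cutoff_le_inv hε v
  rw [← integral_const_mul]
  refine integral_mono_of_nonneg ?_
    ((integrable_bounded_mul (continuous_cutoff hε.le) hb hi).const_mul 2) ?_
  · filter_upwards [hn] with v hv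
    exact mul_nonneg (mul_deriv_cutoff_nonneg hε.le v) hv
  · filter_upwards [hn] with v hv
    have hv' : 0 ≤ h v := hv
    have := mul_le_mul_of_nonneg_right (mul_deriv_cutoff_le hε.le v) hv'
    linarith

/-- Gronwall's inequality for the cut-off second moment. -/
lemma IsWeakSolution.integral_cutoff_le (hg : IsWeakSolution p q g₀ g) (hg₀ : Normalized g₀)
    (hpq : p ^ 2 + q ^ 2 < 1) {ε : ℝ} (hε : 0 < ε) {t : ℝ} (ht : 0 < t) :
    ∫ v, cutoff ε v * g t v ≤ 2 * Real.exp (2 * t) := by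
  have hexp : ∀ s : ℝ, HasDerivAt (fun s : ℝ => Real.exp (-2 * s)) (Real.exp (-2 * s) * -2) s :=
    fun s => by simpa using ((hasDerivAt_id s).const_mul (-2 : ℝ)).exp
  have hd := fun s (hs : 0 < s) => (hexp s).mul (hg.equation _ (isTest_cutoff hε) s hs)
  have h0 : Tendsto (fun s => Real.exp (-2 * s) * ∫ v, cutoff ε v * g s v) (𝓝[>] 0)
      (𝓝 (1 * ∫ v, cutoff ε v * g₀ v)) := by
    refine Tendsto.mul ?_ (hg.tendsto_initial _ (isTest_cutoff hε))
    have : Tendsto (fun s : ℝ => Real.exp (-2 * s)) (𝓝 0) (𝓝 (Real.exp (-2 * 0))) :=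
      (by fun_prop : Continuous fun s : ℝ => Real.exp (-2 * s)).tendsto 0
    simp only [mul_zero, Real.exp_zero] at this
    exact this.mono_left nhdsWithin_le_nhds
  have hle := le_of_tendsto_of_hasDerivAt_nonpos hd (fun s hs => ?_) h0 ht
  · have hinit : ∫ v, cutoff ε v * g₀ v ≤ 2 := by
      have he : ∫ v, (1 + v ^ 2) * g₀ v = 2 := by
        simp only [add_mul, one_mul]
        rw [integral_add hg₀.integrable hg₀.integrable_sq, hg₀.mass, hg₀.energy]; norm_num
      rw [← he]
      refine integral_mono_of_nonneg ?_ (integrable_one_add_sq_mul hg₀.integrable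
        hg₀.integrable_sq) ?_
      · filter_upwards [hg₀.nonneg] with v hv
        exact mul_nonneg (cutoff_nonneg hε.le v) hv
      · filter_upwards [hg₀.nonneg] with v hv
        exact mul_le_mul_of_nonneg_right (cutoff_le hε.le v) hv
    have h3 : Real.exp (2 * t) * (Real.exp (-2 * t) * ∫ v, cutoff ε v * g t v)
        = ∫ v, cutoff ε v * g t v := by
      rw [← mul_assoc, ← Real.exp_add]; simp
    rw [← h3]
    have : Real.exp (-2 * t) * ∫ v, cutoff ε v * g t v ≤ 2 := by
      simp only [Pi.mul_apply] at hle
      linarith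
    nlinarith [Real.exp_pos (2 * t)]
  · have h1 := collision_cutoff_le (hg.nonneg s hs.le) (hg.integrable s hs.le)
      (hg.integral_eq_one hg₀ hs.le) hpq hε
    have h2 := drift_cutoff_le (hg.nonneg s hs.le) (hg.integrable s hs.le) hε
    have h3 : 0 ≤ ∫ v, v * deriv (cutoff ε) v * g s v := by
      refine integral_nonneg_of_ae ?_
      filter_upwards [hg.nonneg s hs.le] with v hv
      exact mul_nonneg (mul_deriv_cutoff_nonneg hε.le v) hv
    have h4 : collision p q (g s) (cutoff ε)
        - 1 / 2 * (p ^ 2 + q ^ 2 - 1) * ∫ v, v * deriv (cutoff ε) v * g s v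
        ≤ 2 * ∫ v, cutoff ε v * g s v := by
      nlinarith [sq_nonneg p, sq_nonneg q]
    have h5 := mul_le_mul_of_nonneg_left h4 (Real.exp_pos (-2 * s)).le
    linarith

/-- Weak solutions keep a finite second moment, locally bounded in time. -/
lemma IsWeakSolution.second_moment (hg : IsWeakSolution p q g₀ g) (hg₀ : Normalized g₀)
    (hpq : p ^ 2 + q ^ 2 < 1) {t : ℝ} (ht : 0 < t) :
    Integrable (fun v : ℝ => v ^ 2 * g t v) ∧
      ∫ v, (1 + v ^ 2) * g t v ≤ 2 * Real.exp (2 * t) := by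
  have hn := hg.nonneg t ht.le
  have hi := hg.integrable t ht.le
  have hε : ∀ n : ℕ, 0 < (1 / ((n : ℝ) + 1)) := fun n => by positivity
  have hcut : ∀ n : ℕ, Integrable (fun v => cutoff (1 / ((n : ℝ) + 1)) v * g t v) := fun n =>
    integrable_bounded_mul (continuous_cutoff (hε n).le) (fun v => by
      rw [abs_of_nonneg (cutoff_nonneg (hε n).le v)]; exact cutoff_le_inv (hε n) v) hi
  have hlim : ∀ v, Tendsto (fun n : ℕ => cutoff (1 / ((n : ℝ) + 1)) v * g t v) atTop
      (𝓝 ((1 + v ^ 2) * g t v)) := by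
    intro v
    refine Tendsto.mul_const _ ?_
    have h0 : Tendsto (fun n : ℕ => 1 + 1 / ((n : ℝ) + 1) * (1 + v ^ 2)) atTop
        (𝓝 (1 + 0 * (1 + v ^ 2))) :=
      (tendsto_one_div_add_atTop_nhds_zero_nat.mul_const _).const_add 1
    have h1 := (tendsto_const_nhds (x := 1 + v ^ 2)).div h0 (by simp)
    rw [zero_mul, add_zero, div_one] at h1
    exact h1
  have hint : Integrable (fun v : ℝ => (1 + v ^ 2) * g t v) := by
    refine integrable_of_tendsto (.of_forall hlim) (fun n => (hcut n).aestronglyMeasurable) ?_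
    refine ne_top_of_le_ne_top (b := ENNReal.ofReal (2 * Real.exp (2 * t))) ENNReal.ofReal_ne_top ?_
    refine liminf_le_of_le (by isBoundedDefault) fun b hb => ?_
    obtain ⟨n, hbn⟩ := hb.exists
    refine hbn.trans ?_
    rw [← ofReal_integral_norm_eq_lintegral_enorm (hcut n)]
    refine ENNReal.ofReal_le_ofReal (le_trans (le_of_eq (integral_congr_ae ?_))
      (hg.integral_cutoff_le hg₀ hpq (hε n) ht))
    filter_upwards [hn] with v hv
    exact Real.norm_of_nonneg (mul_nonneg (cutoff_nonneg (hε n).le v) hv)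
  refine ⟨(hint.sub hi).congr (.of_forall fun v => by simp only [Pi.sub_apply]; ring), ?_⟩
  have htend := tendsto_integral_of_dominated_convergence _
    (fun n => (hcut n).aestronglyMeasurable) hint (fun n => ?_) (.of_forall hlim)
  · exact le_of_tendsto' htend fun n => hg.integral_cutoff_le hg₀ hpq (hε n) ht
  · filter_upwards [hn] with v hv
    rw [Real.norm_of_nonneg (mul_nonneg (cutoff_nonneg (hε n).le v) hv)]
    exact mul_le_mul_of_nonneg_right (cutoff_le (hε n).le v) hv

end Moments

/-! ### The equation in Fourier variables -/

section FourierEquation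

variable {p q : ℝ} {h : ℝ → ℝ}

lemma collision_cos (hi : Integrable h) (h1 : ∫ v, h v = 1) (ξ θ : ℝ) :
    collision p q h (fun v => Real.cos (ξ * v + θ))
      = (Complex.exp (-(θ : ℂ) * Complex.I)
          * (fourierTr h (p * ξ) * fourierTr h (q * ξ) - fourierTr h ξ)).re := by
  have hC := re_fourierTr_mul hi (q * ξ) 0
  have hS := im_fourierTr_mul hi (q * ξ) 0
  simp only [Complex.ofReal_zero, neg_zero, zero_mul, Complex.exp_zero, one_mul] at hC hS
  have hinner : ∀ v, ∫ w, h v * h w * (Real.cos (ξ * (p * v + q * w) + θ) - Real.cos (ξ * v + θ))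
      = (fourierTr h (q * ξ)).re * (Real.cos (p * ξ * v + θ) * h v)
        + (fourierTr h (q * ξ)).im * (Real.sin (p * ξ * v + θ) * h v)
        - Real.cos (ξ * v + θ) * h v := by
    intro v
    have e : ∀ w, h v * h w * (Real.cos (ξ * (p * v + q * w) + θ) - Real.cos (ξ * v + θ))
        = h v * Real.cos (p * ξ * v + θ) * (Real.cos (q * ξ * w + 0) * h w)
          - h v * Real.sin (p * ξ * v + θ) * (Real.sin (q * ξ * w + 0) * h w)
          - h v * Real.cos (ξ * v + θ) * h w := by
      intro w
      rw [show ξ * (p * v + q * w) + θ = (p * ξ * v + θ) + (q * ξ * w + 0) by ring, Real.cos_add]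
      ring
    simp_rw [e]
    rw [integral_sub, integral_sub, integral_const_mul, integral_const_mul, integral_const_mul,
      h1, ← hC, hS]
    · ring
    · exact (integrable_cos_mul hi _ _).const_mul _
    · exact (integrable_sin_mul hi _ _).const_mul _
    · exact ((integrable_cos_mul hi _ _).const_mul _).sub ((integrable_sin_mul hi _ _).const_mul _)
    · exact hi.const_mul _
  rw [collision]
  simp_rw [hinner]
  rw [integral_sub, integral_add, integral_const_mul, integral_const_mul,
    ← re_fourierTr_mul hi, ← re_fourierTr_mul hi,
    ← neg_neg (∫ v, Real.sin (p * ξ * v + θ) * h v), ← im_fourierTr_mul hi, mul_sub, ← mul_assoc,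
    Complex.sub_re, Complex.mul_re (_ * _)]
  · ring
  · exact (integrable_cos_mul hi _ _).const_mul _
  · exact (integrable_sin_mul hi _ _).const_mul _
  · exact ((integrable_cos_mul hi _ _).const_mul _).add ((integrable_sin_mul hi _ _).const_mul _)
  · exact integrable_cos_mul hi _ _

lemma drift_cos (hi1 : Integrable (fun v : ℝ => v * h v)) (ξ θ : ℝ) :
    ∫ v, v * deriv (fun v => Real.cos (ξ * v + θ)) v * h v
      = (Complex.exp (-(θ : ℂ) * Complex.I) * (ξ * fourierDeriv h ξ)).re := by
  have hd : ∀ v, deriv (fun v => Real.cos (ξ * v + θ)) v = -Real.sin (ξ * v + θ) * ξ := by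
    intro v
    have := (((hasDerivAt_id v).const_mul ξ).add_const θ).cos
    simpa using this.deriv
  rw [mul_left_comm, Complex.re_ofReal_mul, re_fourierDeriv_mul hi1, ← integral_const_mul]
  congr 1; ext v
  rw [hd]; ring

/-- The time derivative `ĥ(pξ) ĥ(qξ) - ĥ(ξ) - ½ (p² + q² - 1) ξ ĥ'(ξ)` prescribed by the scaled
equation. -/
noncomputable def fourierRate (p q : ℝ) (h : ℝ → ℝ) (ξ : ℝ) : ℂ :=
  fourierTr h (p * ξ) * fourierTr h (q * ξ) - fourierTr h ξ
    - ((1 / 2 * (p ^ 2 + q ^ 2 - 1) : ℝ) : ℂ) * (ξ * fourierDeriv h ξ)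

variable {g₀ : ℝ → ℝ} {g : ℝ → ℝ → ℝ}

lemma hasDerivAt_of_re_of_im {f : ℝ → ℂ} {f' : ℂ} {t : ℝ}
    (hre : HasDerivAt (fun s => (f s).re) f'.re t)
    (him : HasDerivAt (fun s => (f s).im) f'.im t) : HasDerivAt f f' t := by
  have := hre.ofReal_comp.add (him.ofReal_comp.mul_const Complex.I)
  rw [Complex.re_add_im] at this
  refine this.congr_of_eventuallyEq (.of_forall fun s => ?_)
  simp [Complex.re_add_im]

lemma exp_neg_pi_div_two_mul_I_re (z : ℂ) :
    (Complex.exp (-((Real.pi / 2 : ℝ) : ℂ) * Complex.I) * z).re = z.im := by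
  rw [← Complex.ofReal_neg, Complex.mul_re, Complex.exp_ofReal_mul_I_re,
    Complex.exp_ofReal_mul_I_im]
  simp

lemma exp_neg_zero_mul_I_re (z : ℂ) :
    (Complex.exp (-((0 : ℝ) : ℂ) * Complex.I) * z).re = z.re := by
  simp

lemma IsWeakSolution.hasDerivAt_fourierTr_time (hg : IsWeakSolution p q g₀ g)
    (hg₀ : Normalized g₀) (ξ : ℝ) {t : ℝ} (ht : 0 < t) :
    HasDerivAt (fun s => fourierTr (g s) ξ) (fourierRate p q (g t) ξ) t := by
  have key : ∀ θ : ℝ, HasDerivAt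
      (fun s => (Complex.exp (-(θ : ℂ) * Complex.I) * fourierTr (g s) ξ).re)
      (Complex.exp (-(θ : ℂ) * Complex.I) * fourierRate p q (g t) ξ).re t := by
    intro θ
    have h1 := hg.equation _ (isTest_cos ξ θ) t ht
    rw [collision_cos (hg.integrable t ht.le) (hg.integral_eq_one hg₀ ht.le),
      drift_cos (hg.integrable_mul t ht.le)] at h1
    refine (h1.congr_of_eventuallyEq ?_).congr_deriv ?_
    · filter_upwards [Ioi_mem_nhds ht] with s hs
      exact re_fourierTr_mul (hg.integrable s (le_of_lt hs)) ξ θ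
    · rw [fourierRate, mul_sub _ (_ - _), Complex.sub_re,
        mul_left_comm _ ((1 / 2 * (p ^ 2 + q ^ 2 - 1) : ℝ) : ℂ), Complex.re_ofReal_mul]
  refine hasDerivAt_of_re_of_im ?_ ?_
  · simpa only [exp_neg_zero_mul_I_re] using key 0
  · simpa only [exp_neg_pi_div_two_mul_I_re] using key (Real.pi / 2)

lemma IsWeakSolution.tendsto_fourierTr_zero (hg : IsWeakSolution p q g₀ g)
    (hg₀ : Normalized g₀) (ξ : ℝ) :
    Tendsto (fun s => fourierTr (g s) ξ) (𝓝[>] 0) (𝓝 (fourierTr g₀ ξ)) := by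
  have key : ∀ θ : ℝ, Tendsto
      (fun s => (Complex.exp (-(θ : ℂ) * Complex.I) * fourierTr (g s) ξ).re) (𝓝[>] 0)
      (𝓝 (Complex.exp (-(θ : ℂ) * Complex.I) * fourierTr g₀ ξ).re) := by
    intro θ
    rw [re_fourierTr_mul hg₀.integrable]
    refine (hg.tendsto_initial _ (isTest_cos ξ θ)).congr' ?_
    filter_upwards [self_mem_nhdsWithin] with s hs
    exact (re_fourierTr_mul (hg.integrable s (le_of_lt hs)) ξ θ).symm
  have hre := key 0
  have him := key (Real.pi / 2)
  simp only [exp_neg_zero_mul_I_re] at hre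
  simp only [exp_neg_pi_div_two_mul_I_re] at him
  have := ((Complex.continuous_ofReal.tendsto _).comp hre).add
    (((Complex.continuous_ofReal.tendsto _).comp him).mul_const Complex.I)
  rw [Complex.re_add_im] at this
  refine this.congr fun s => ?_
  simp [Complex.re_add_im]

lemma IsWeakSolution.norm_fourierTr_le_one (hg : IsWeakSolution p q g₀ g)
    (hg₀ : Normalized g₀) {t : ℝ} (ht : 0 ≤ t) (ξ : ℝ) : ‖fourierTr (g t) ξ‖ ≤ 1 :=
  (norm_fourierTr_le (hg.nonneg t ht) ξ).trans_eq (hg.integral_eq_one hg₀ ht)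

lemma fourierRate_lipschitz {M A : ℝ} (hpq : p ^ 2 + q ^ 2 < 1) (hn : 0 ≤ᵐ[volume] h)
    (hi : Integrable h) (h1 : ∫ v, h v = 1) (hi1 : Integrable (fun v : ℝ => v * h v))
    (hi2 : Integrable (fun v : ℝ => v ^ 2 * h v)) (hM : ∫ v, (1 + v ^ 2) * h v ≤ M)
    {ξ η : ℝ} (hη : |η| ≤ A) :
    ‖fourierRate p q h ξ - fourierRate p q h η‖ ≤ M * (4 + A) * |ξ - η| := by
  have hp1 : |p| ≤ 1 := by rw [← sq_le_one_iff_abs_le_one]; nlinarith [sq_nonneg q]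
  have hq1 : |q| ≤ 1 := by rw [← sq_le_one_iff_abs_le_one]; nlinarith [sq_nonneg p]
  have hM0 : 0 ≤ M := (norm_nonneg _).trans ((norm_fourierDeriv_le hn hi hi2 0).trans hM)
  have hone : ∀ x, ‖fourierTr h x‖ ≤ 1 := fun x => (norm_fourierTr_le hn x).trans_eq h1
  have hlip : ∀ x y, ‖fourierTr h x - fourierTr h y‖ ≤ M * |x - y| := fun x y =>
    (norm_fourierTr_sub_le hn hi hi1 hi2 x y).trans (by gcongr)
  have hscale : ∀ r : ℝ, |r| ≤ 1 →
      ‖fourierTr h (r * ξ) - fourierTr h (r * η)‖ ≤ M * |ξ - η| := by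
    intro r hr
    refine (hlip _ _).trans ?_
    rw [← mul_sub, abs_mul]
    gcongr
    exact mul_le_of_le_one_left (abs_nonneg _) hr
  have hprod : ‖fourierTr h (p * ξ) * fourierTr h (q * ξ)
      - fourierTr h (p * η) * fourierTr h (q * η)‖ ≤ 2 * (M * |ξ - η|) := by
    rw [show fourierTr h (p * ξ) * fourierTr h (q * ξ) - fourierTr h (p * η) * fourierTr h (q * η)
      = fourierTr h (p * ξ) * (fourierTr h (q * ξ) - fourierTr h (q * η))
        + (fourierTr h (p * ξ) - fourierTr h (p * η)) * fourierTr h (q * η) by ring]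
    refine (norm_add_le _ _).trans ?_
    rw [norm_mul, norm_mul]
    have a1 := mul_le_mul (hone (p * ξ)) (hscale q hq1) (norm_nonneg _) zero_le_one
    have a2 := mul_le_mul (hscale p hp1) (hone (q * η)) (norm_nonneg _) (by positivity)
    linarith
  have hdrift : ‖(ξ : ℂ) * fourierDeriv h ξ - η * fourierDeriv h η‖ ≤ (1 + A) * (M * |ξ - η|) := by
    rw [show (ξ : ℂ) * fourierDeriv h ξ - η * fourierDeriv h η
      = ((ξ - η : ℝ) : ℂ) * fourierDeriv h ξ + η * (fourierDeriv h ξ - fourierDeriv h η) by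
        push_cast; ring]
    refine (norm_add_le _ _).trans ?_
    rw [norm_mul, norm_mul, Complex.norm_real, Complex.norm_real, Real.norm_eq_abs,
      Real.norm_eq_abs]
    have a1 := mul_le_mul_of_nonneg_left ((norm_fourierDeriv_le hn hi hi2 ξ).trans hM)
      (abs_nonneg (ξ - η))
    have a2 : |η| * ‖fourierDeriv h ξ - fourierDeriv h η‖ ≤ A * (M * |ξ - η|) := by
      refine mul_le_mul hη ?_ (norm_nonneg _) ((abs_nonneg η).trans hη)
      exact (norm_fourierDeriv_sub_le hn hi hi1 hi2 ξ η).trans (by gcongr)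
    linarith
  have hcoef : ‖((1 / 2 * (p ^ 2 + q ^ 2 - 1) : ℝ) : ℂ)‖ ≤ 1 := by
    rw [Complex.norm_real, Real.norm_eq_abs, abs_le]
    constructor <;> nlinarith [sq_nonneg p, sq_nonneg q]
  rw [fourierRate, fourierRate, sub_sub_sub_comm, ← mul_sub, sub_sub_sub_comm]
  refine (norm_sub_le _ _).trans ?_
  have a1 := (norm_sub_le (fourierTr h (p * ξ) * fourierTr h (q * ξ)
      - fourierTr h (p * η) * fourierTr h (q * η)) (fourierTr h ξ - fourierTr h η))
  have a2 := hlip ξ η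
  have a3 : ‖((1 / 2 * (p ^ 2 + q ^ 2 - 1) : ℝ) : ℂ)
      * ((ξ : ℂ) * fourierDeriv h ξ - η * fourierDeriv h η)‖ ≤ 1 * ((1 + A) * (M * |ξ - η|)) := by
    rw [norm_mul]
    exact mul_le_mul hcoef hdrift (norm_nonneg _) zero_le_one
  linarith

/-! ### Differentiation along characteristics -/

/-- Chain rule for `s ↦ f (γ s) s`, when the partial derivative in time is Lipschitz in space
near the point. -/
lemma hasDerivAt_along_curve {f H : ℝ → ℝ → ℂ} {γ : ℝ → ℝ} {γ' t r L : ℝ} {D : ℂ} (hr : 0 < r)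
    (hγ : HasDerivAt γ γ' t) (hx : HasDerivAt (fun x => f x t) D (γ t))
    (ht : ∀ x, ∀ s ∈ Metric.ball t r, HasDerivAt (f x) (H x s) s)
    (hL : ∀ x ∈ Metric.ball (γ t) r, ∀ s ∈ Metric.ball t r,
      ‖H x s - H (γ t) s‖ ≤ L * |x - γ t|) :
    HasDerivAt (fun s => f (γ s) s) (H (γ t) t + γ' • D) t := by
  have htb : t ∈ Metric.ball t r := Metric.mem_ball_self hr
  have hmain := (ht (γ t) t htb).add (hx.scomp t hγ)
  -- the mixed second difference is of second order
  have herr : HasDerivAt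
      (fun s => (f (γ s) s - f (γ t) s) - (f (γ s) t - f (γ t) t)) 0 t := by
    rw [hasDerivAt_iff_isLittleO]
    simp only [sub_self, smul_zero, sub_zero]
    have hsmall : (fun s => (γ s - γ t) * (s - t)) =o[𝓝 t] fun s => s - t := by
      have h0 : Tendsto (fun s => γ s - γ t) (𝓝 t) (𝓝 0) := by
        simpa using hγ.continuousAt.tendsto.sub_const (γ t)
      simpa using (Asymptotics.isLittleO_one_iff ℝ |>.2 h0).mul_isBigO
        (Asymptotics.isBigO_refl (fun s => s - t) (𝓝 t))
    refine Asymptotics.IsBigO.trans_isLittleO (Asymptotics.IsBigO.of_bound L ?_) hsmall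
    filter_upwards [Metric.ball_mem_nhds t hr,
      hγ.continuousAt.preimage_mem_nhds (Metric.ball_mem_nhds (γ t) hr)] with s hs hγs
    have := (convex_ball t r).norm_image_sub_le_of_norm_hasDerivWithin_le
      (f := fun s' => f (γ s) s' - f (γ t) s') (f' := fun s' => H (γ s) s' - H (γ t) s')
      (C := L * |γ s - γ t|) (x := t) (y := s)
      (fun s' hs' => ((ht _ s' hs').sub (ht _ s' hs')).hasDerivWithinAt)
      (fun s' hs' => hL _ hγs s' hs') htb hs
    rw [norm_mul, Real.norm_eq_abs (γ s - γ t), ← mul_assoc]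
    exact this
  have hsum := (hmain.add herr).sub_const (f (γ t) t)
  rw [add_zero] at hsum
  refine hsum.congr_of_eventuallyEq (.of_forall fun s => ?_)
  simp only [Pi.add_apply, Function.comp_apply]
  ring

/-- Along the characteristics `ξ' = ½ (p² + q² - 1) ξ` the drift disappears. -/
lemma IsWeakSolution.hasDerivAt_characteristic (hg : IsWeakSolution p q g₀ g)
    (hg₀ : Normalized g₀) (hpq : p ^ 2 + q ^ 2 < 1) {γ : ℝ → ℝ}
    {t : ℝ} (ht : 0 < t) (hγ : HasDerivAt γ (1 / 2 * (p ^ 2 + q ^ 2 - 1) * γ t) t) :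
    HasDerivAt (fun s => fourierTr (g s) (γ s))
      (fourierTr (g t) (p * γ t) * fourierTr (g t) (q * γ t) - fourierTr (g t) (γ t)) t := by
  have hpos : ∀ s ∈ Metric.ball t t, 0 < s := fun s hs => by
    rw [Metric.mem_ball, Real.dist_eq, abs_lt] at hs; linarith
  refine (hasDerivAt_along_curve (f := fun x s => fourierTr (g s) x)
    (H := fun x s => fourierRate p q (g s) x) (D := fourierDeriv (g t) (γ t))
    (L := 2 * Real.exp (2 * (2 * t)) * (4 + |γ t|)) ht hγ
    (hasDerivAt_fourierTr (hg.integrable t ht.le) (hg.integrable_mul t ht.le) _)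
    (fun x s hs => hg.hasDerivAt_fourierTr_time hg₀ x (hpos s hs)) ?_).congr_deriv ?_
  · intro x _ s hs
    have hs0 := hpos s hs
    obtain ⟨h2, hM⟩ := hg.second_moment hg₀ hpq hs0
    refine fourierRate_lipschitz hpq (hg.nonneg s hs0.le) (hg.integrable s hs0.le)
      (hg.integral_eq_one hg₀ hs0.le) (hg.integrable_mul s hs0.le) h2 (hM.trans ?_) le_rfl
    rw [Metric.mem_ball, Real.dist_eq, abs_lt] at hs
    gcongr
    linarith
  · simp only [fourierRate, Complex.real_smul]
    push_cast
    ring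

lemma IsWeakSolution.tendsto_fourierTr_curve (hg : IsWeakSolution p q g₀ g)
    (hg₀ : Normalized g₀) (hpq : p ^ 2 + q ^ 2 < 1) {γ : ℝ → ℝ}
    (hγ : ContinuousAt γ 0) :
    Tendsto (fun s => fourierTr (g s) (γ s)) (𝓝[>] 0) (𝓝 (fourierTr g₀ (γ 0))) := by
  have h0 := hg.tendsto_fourierTr_zero hg₀ (γ 0)
  have hγ0 : Tendsto (fun s => 2 * Real.exp (2 * 1) * |γ s - γ 0|) (𝓝[>] 0) (𝓝 0) := by
    have h1 : Tendsto (fun s => γ s - γ 0) (𝓝[>] 0) (𝓝 0) := by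
      simpa using (hγ.tendsto.mono_left nhdsWithin_le_nhds).sub_const (γ 0)
    simpa using h1.abs.const_mul (2 * Real.exp (2 * 1))
  have hdiff : Tendsto (fun s => fourierTr (g s) (γ s) - fourierTr (g s) (γ 0)) (𝓝[>] 0)
      (𝓝 0) := by
    refine squeeze_zero_norm' ?_ hγ0
    filter_upwards [Ioo_mem_nhdsGT (zero_lt_one (α := ℝ))] with s hs
    obtain ⟨h2, hM⟩ := hg.second_moment hg₀ hpq hs.1
    refine (norm_fourierTr_sub_le (hg.nonneg s hs.1.le) (hg.integrable s hs.1.le)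
      (hg.integrable_mul s hs.1.le) h2 _ _).trans ?_
    gcongr
    refine hM.trans ?_
    gcongr
    exact hs.2.le
  simpa using hdiff.add h0

end FourierEquation

/-! ### Comparison with the supersolution -/

section Comparison

variable {p q m δ κ : ℝ} {g₀ : ℝ → ℝ} {g : ℝ → ℝ → ℝ}

lemma continuousOn_profile (hm2 : m < 2) (hδ : 0 < δ) :
    ContinuousOn (profile m δ) (Set.Ioi 0) := by
  intro x hx
  have h1 : ContinuousAt (profileFactor m δ) (min x 1) := by
    unfold profileFactor
    exact (Real.continuous_rpow_const (by linarith)).continuousAt.sub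
      ((Real.continuous_rpow_const (by linarith)).continuousAt.const_mul _)
  have h2 : ContinuousAt (fun x : ℝ => min x 1) x := by fun_prop
  exact ((Real.continuousAt_rpow_const x m (Or.inl (ne_of_gt hx))).mul
    (ContinuousAt.comp (g := profileFactor m δ) h1 h2)).continuousWithinAt

/-- The characteristic `s ↦ x e^{d (t - s)}` passes through `x` at time `t`. -/
lemma hasDerivAt_const_mul_exp (x d t s : ℝ) :
    HasDerivAt (fun s => x * Real.exp (d * (t - s))) (-d * (x * Real.exp (d * (t - s)))) s := by
  have := ((((hasDerivAt_id s).const_sub t).const_mul d).exp).const_mul x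
  refine this.congr_deriv ?_
  simp; ring

/-- The right derivative of `exp (-κ e)` along a characteristic. Frequencies decrease in modulus,
so that only the left derivative of the profile enters. -/
lemma hasDerivWithinAt_supersolution {x d t s : ℝ} (hx : 0 < x) (hd : 0 < d) :
    HasDerivWithinAt (fun s => Real.exp (-κ * profile m δ (x * Real.exp (d * (t - s)))))
      (Real.exp (-κ * profile m δ (x * Real.exp (d * (t - s))))
        * (κ * (d * profileSlope m δ (x * Real.exp (d * (t - s)))))) (Set.Ici s) s := by
  have hy : 0 < x * Real.exp (d * (t - s)) := by positivity
  have h1 := (profile_hasDerivWithinAt (m := m) (δ := δ) hy).comp s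
    (hasDerivAt_const_mul_exp x d t s).hasDerivWithinAt (s := Set.Ici s) (by
      intro r hr
      have hr' : s ≤ r := hr
      simp only [Set.mem_Iic]
      gcongr)
  refine (h1.const_mul (-κ)).exp.congr_deriv ?_
  simp only [Function.comp_apply]
  field_simp

/-- One step of the iteration: an excess of at most `(2s)^n / n!` over the supersolution at all
times improves to `(2s)^(n+1) / (n+1)!`, by integrating along characteristics. -/
lemma IsWeakSolution.comparison_step (hg : IsWeakSolution p q g₀ g) (hg₀ : Normalized g₀)
    (hpq : p ^ 2 + q ^ 2 < 1) (hp : 0 < p) (hq : 0 < q) (hm0 : 0 < m) (hm2 : m < 2) (hδ : 0 < δ)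
    (hκ : 0 < κ)
    (hsuper : ∀ x, 0 < x →
      Real.exp (κ * (profile m δ x - profile m δ (p * x) - profile m δ (q * x)))
        ≤ 1 + κ * ((1 - p ^ 2 - q ^ 2) / 2 * profileSlope m δ x))
    (hinit : ∀ ξ, ‖fourierTr g₀ ξ‖ ≤ Real.exp (-κ * profile m δ |ξ|)) (n : ℕ)
    (ih : ∀ t, 0 ≤ t → ∀ ξ, ‖fourierTr (g t) ξ‖
      ≤ Real.exp (-κ * profile m δ |ξ|) + (2 * t) ^ n / n.factorial) :
    ∀ t, 0 ≤ t → ∀ ξ, ‖fourierTr (g t) ξ‖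
      ≤ Real.exp (-κ * profile m δ |ξ|) + (2 * t) ^ (n + 1) / (n + 1).factorial := by
  intro t ht ξ
  rcases eq_or_ne ξ 0 with rfl | hξ
  · refine (hg.norm_fourierTr_le_one hg₀ ht 0).trans ?_
    rw [abs_zero, profile_zero hm0, mul_zero, Real.exp_zero]
    have : 0 ≤ (2 * t) ^ (n + 1) / ((n + 1).factorial : ℝ) := by positivity
    linarith
  set d := (1 - p ^ 2 - q ^ 2) / 2 with hd_def
  have hd : 0 < d := by rw [hd_def]; linarith
  have hx : 0 < |ξ| := abs_pos.2 hξ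
  set γ : ℝ → ℝ := fun s => ξ * Real.exp (d * (t - s)) with hγ_def
  set x : ℝ → ℝ := fun s => |ξ| * Real.exp (d * (t - s)) with hx_def
  have hγabs : ∀ s, |γ s| = x s := fun s => by
    rw [hγ_def, hx_def, abs_mul, Real.abs_exp]
  have hxpos : ∀ s, 0 < x s := fun s => by rw [hx_def]; positivity
  have hγd : ∀ s, HasDerivAt γ (1 / 2 * (p ^ 2 + q ^ 2 - 1) * γ s) s := fun s => by
    refine (hasDerivAt_const_mul_exp ξ d t s).congr_deriv ?_
    rw [hγ_def, hd_def]; ring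
  have hγc : ∀ s, ContinuousAt γ s := fun s => (hγd s).continuousAt
  have hzero : fourierTr (g 0) = fourierTr g₀ := by
    ext η
    refine integral_congr_ae ?_
    filter_upwards [hg.initial] with v hv
    rw [hv]
  set N : ℝ → ℂ := fun s => fourierTr (g s) (p * γ s) * fourierTr (g s) (q * γ s) with hN
  set F : ℝ → ℂ := fun s => Real.exp s • fourierTr (g s) (γ s) with hF
  have hFd : ∀ s, 0 < s → HasDerivAt F (Real.exp s • N s) s := fun s hs => by
    refine ((Real.hasDerivAt_exp s).smul
      (hg.hasDerivAt_characteristic hg₀ hpq hs (hγd s))).congr_deriv ?_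
    rw [hN, smul_sub]; simp
  have hexp0 : Tendsto Real.exp (𝓝[>] 0) (𝓝 (Real.exp 0)) :=
    (Real.continuous_exp.tendsto 0).mono_left nhdsWithin_le_nhds
  -- the equation holds only for positive times; at `0` the right derivative is a limit
  have hF0 : ContinuousWithinAt F (Set.Ioi 0) 0 := by
    have := hexp0.smul (hg.tendsto_fourierTr_curve hg₀ hpq (hγc 0))
    rw [← hzero] at this
    exact this
  have hFd0 : HasDerivWithinAt F (Real.exp 0 • N 0) (Set.Ici 0) 0 := by
    refine hasDerivWithinAt_Ici_of_tendsto_deriv (s := Set.Ioi 0)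
      (fun s hs => (hFd s hs).differentiableAt.differentiableWithinAt) hF0
      self_mem_nhdsWithin ?_
    have h1 := hexp0.smul ((hg.tendsto_fourierTr_curve hg₀ hpq ((hγc 0).const_mul p)).mul
      (hg.tendsto_fourierTr_curve hg₀ hpq ((hγc 0).const_mul q)))
    rw [← hzero] at h1
    refine h1.congr' ?_
    filter_upwards [self_mem_nhdsWithin] with s hs
    exact (hFd s hs).deriv.symm
  have hFdr : ∀ s ∈ Set.Ico 0 t, HasDerivWithinAt F (Real.exp s • N s) (Set.Ici s) s := by
    intro s hs
    rcases hs.1.eq_or_lt with rfl | h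
    · exact hFd0
    · exact (hFd s h).hasDerivWithinAt
  have hFc : ContinuousOn F (Set.Icc 0 t) := by
    intro s hs
    rcases hs.1.eq_or_lt with rfl | h
    · exact hFd0.continuousWithinAt.mono fun r hr => hr.1
    · exact (hFd s h).continuousAt.continuousWithinAt
  set b : ℝ → ℝ := fun s => Real.exp (-κ * profile m δ (x s)) with hb
  set w : ℝ → ℝ := fun s => (2 * s) ^ n / n.factorial with hw
  set W : ℝ → ℝ := fun s => (2 * s) ^ (n + 1) / (n + 1).factorial with hW
  have hWd : ∀ s, HasDerivAt W (2 * w s) s := fun s => by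
    have := ((((hasDerivAt_id s).const_mul 2).pow (n + 1)).div_const ((n + 1).factorial : ℝ))
    refine this.congr_deriv ?_
    rw [hw, Nat.factorial_succ]
    push_cast
    simp only [id]
    field_simp
  have hbd : ∀ s, HasDerivWithinAt b (b s * (κ * (d * profileSlope m δ (x s)))) (Set.Ici s) s :=
    fun s => hasDerivWithinAt_supersolution hx hd
  have hBd : ∀ s, HasDerivWithinAt (fun s => Real.exp s * (b s + W s))
      (Real.exp s * (b s + W s) + Real.exp s * (b s * (κ * (d * profileSlope m δ (x s))) + 2 * w s))
      (Set.Ici s) s := fun s =>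
    (Real.hasDerivAt_exp s).hasDerivWithinAt.mul ((hbd s).add (hWd s).hasDerivWithinAt)
  have hbc : Continuous b := by
    have hxc : Continuous x := by rw [hx_def]; fun_prop
    exact Real.continuous_exp.comp
      (((continuousOn_profile hm2 hδ).comp_continuous hxc hxpos).const_mul (-κ))
  have hWc : Continuous W := by rw [hW]; fun_prop
  have hB0 : ‖F 0‖ ≤ Real.exp 0 * (b 0 + W 0) := by
    have := hinit (γ 0)
    rw [hγabs] at this
    simpa [hF, hW, hb, hzero] using this
  have hbound : ∀ s ∈ Set.Ico 0 t, ‖Real.exp s • N s‖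
      ≤ Real.exp s * (b s + W s)
        + Real.exp s * (b s * (κ * (d * profileSlope m δ (x s))) + 2 * w s) := by
    intro s hs
    have hW0 : 0 ≤ W s := by have := hs.1; rw [hW]; positivity
    have hw0 : 0 ≤ w s := by have := hs.1; rw [hw]; positivity
    have hfac : ∀ r : ℝ, 0 < r → ‖fourierTr (g s) (r * γ s)‖
        ≤ Real.exp (-κ * profile m δ (r * x s)) + w s := fun r hr => by
      have := ih s hs.1 (r * γ s)
      rwa [abs_mul, hγabs, abs_of_pos hr] at this
    have hone := hg.norm_fourierTr_le_one hg₀ hs.1 (p * γ s)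
    have hBq : Real.exp (-κ * profile m δ (q * x s)) ≤ 1 := by
      rw [Real.exp_le_one_iff]
      have := mul_nonneg hκ.le (profile_nonneg hm2 hδ (mul_pos hq (hxpos s)).le)
      linarith
    have hprod : Real.exp (-κ * profile m δ (p * x s)) * Real.exp (-κ * profile m δ (q * x s))
        ≤ b s * (1 + κ * (d * profileSlope m δ (x s))) := by
      refine le_trans (le_of_eq ?_)
        (mul_le_mul_of_nonneg_left (hsuper (x s) (hxpos s)) (Real.exp_pos _).le)
      rw [← Real.exp_add, ← Real.exp_add]
      congr 1; ring
    have hNle : ‖N s‖ ≤ b s * (1 + κ * (d * profileSlope m δ (x s))) + 2 * w s := by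
      rw [hN, norm_mul]
      have a1 := mul_le_mul_of_nonneg_left (hfac q hq) (norm_nonneg (fourierTr (g s) (p * γ s)))
      have a2 := mul_le_mul_of_nonneg_right (hfac p hp)
        (Real.exp_pos (-κ * profile m δ (q * x s))).le
      have a3 := mul_le_mul_of_nonneg_right hone hw0
      have a4 := mul_le_mul_of_nonneg_left hBq hw0
      linarith
    rw [norm_smul, Real.norm_eq_abs, Real.abs_exp, ← mul_add]
    refine mul_le_mul_of_nonneg_left ?_ (Real.exp_pos s).le
    linarith
  have hfinal := image_norm_le_of_norm_deriv_right_le_deriv_boundary' hFc hFdr hB0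
    (by fun_prop) (fun s _ => hBd s) hbound (Set.right_mem_Icc.2 ht)
  have hxt : x t = |ξ| := by simp [hx_def]
  have hγt : γ t = ξ := by simp [hγ_def]
  simp only [hF, hb, hW, hxt, hγt, norm_smul, Real.norm_eq_abs, Real.abs_exp] at hfinal
  exact le_of_mul_le_mul_left hfinal (Real.exp_pos t)

/-- Comparison principle: a weak solution that starts below the supersolution stays below it. -/
lemma IsWeakSolution.norm_fourierTr_le_supersolution (hg : IsWeakSolution p q g₀ g)
    (hg₀ : Normalized g₀)
    (hpq : p ^ 2 + q ^ 2 < 1) (hp : 0 < p) (hq : 0 < q) (hm0 : 0 < m) (hm2 : m < 2) (hδ : 0 < δ)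
    (hκ : 0 < κ)
    (hsuper : ∀ x, 0 < x →
      Real.exp (κ * (profile m δ x - profile m δ (p * x) - profile m δ (q * x)))
        ≤ 1 + κ * ((1 - p ^ 2 - q ^ 2) / 2 * profileSlope m δ x))
    (hinit : ∀ ξ, ‖fourierTr g₀ ξ‖ ≤ Real.exp (-κ * profile m δ |ξ|))
    {t : ℝ} (ht : 0 ≤ t) (ξ : ℝ) :
    ‖fourierTr (g t) ξ‖ ≤ Real.exp (-κ * profile m δ |ξ|) := by
  have hall : ∀ n : ℕ, ∀ t, 0 ≤ t → ∀ ξ, ‖fourierTr (g t) ξ‖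
      ≤ Real.exp (-κ * profile m δ |ξ|) + (2 * t) ^ n / n.factorial := by
    intro n
    induction n with
    | zero =>
      intro t ht ξ
      have h1 := hg.norm_fourierTr_le_one hg₀ ht ξ
      have h2 := Real.exp_pos (-κ * profile m δ |ξ|)
      simp only [pow_zero, Nat.factorial_zero, Nat.cast_one, div_one]
      linarith
    | succ n ih => exact hg.comparison_step hg₀ hpq hp hq hm0 hm2 hδ hκ hsuper hinit n ih
  have hlim := (FloorSemiring.tendsto_pow_div_factorial_atTop (2 * t)).const_add
    (Real.exp (-κ * profile m δ |ξ|))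
  rw [add_zero] at hlim
  exact ge_of_tendsto' hlim fun n => hall n t ht ξ

end Comparison

end MaxwellModel

theorem theorem1p3 (p q δ' lam : ℝ) (hq : 0 < q) (hqp : q ≤ p) (hpq : p ^ 2 + q ^ 2 < 1)
    (hδ'0 : 0 < δ') (hδ'1 : δ' < 1)
    (hS : ∀ δ : ℝ, 0 < δ → δ < δ' → MaxwellModel.S p q δ < 0)
    (hlam0 : 0 < lam) (hlam2 : lam < 2) (hlam : p ^ lam + q ^ lam = 1)
    (g₀ : ℝ → ℝ) (hg₀ : MaxwellModel.Normalized g₀)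
    (hmom : Integrable (fun v : ℝ => |v| ^ (2 + δ') * g₀ v))
    (g : ℝ → ℝ → ℝ) (hg : MaxwellModel.IsWeakSolution p q g₀ g)
    (R ν β : ℝ) (hR : 0 < R) (hν : 0 < ν) (hβ : 0 < β)
    (hdecay : ∀ ξ : ℝ, R < |ξ| →
      ‖MaxwellModel.fourierTr g₀ ξ‖ ≤ Real.exp (-β * |ξ| ^ ν)) :
    ∃ ρ κ : ℝ, 0 < ρ ∧ 0 < κ ∧ ∀ t : ℝ, 0 ≤ t → ∀ ξ : ℝ,
      (|ξ| ≤ ρ → ‖MaxwellModel.fourierTr (g t) ξ‖ ≤ Real.exp (-κ * ξ ^ 2)) ∧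
      (ρ < |ξ| →
        ‖MaxwellModel.fourierTr (g t) ξ‖ ≤ Real.exp (-κ * |ξ| ^ (min ν lam))) := by
  open MaxwellModel in
  have hp : 0 < p := hq.trans_le hqp
  set m := min ν lam with hm_def
  have hm0 : 0 < m := lt_min hν hlam0
  have hm2 : m < 2 := (min_le_right _ _).trans_lt hlam2
  obtain ⟨δ, hδ, hδδ'⟩ := exists_between hδ'0
  have hσ : 0 < -S p q δ := neg_pos.2 (hS δ hδ hδδ')
  have hz0 := profileWeight_pos hm2 hδ
  have hz1 := profileWeight_lt_one hm2 hδ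
  have hm : 1 ≤ p ^ m + q ^ m := by
    rw [← hlam]
    exact add_le_add
      (Real.rpow_le_rpow_of_exponent_ge hp (by nlinarith) (min_le_right _ _))
      (Real.rpow_le_rpow_of_exponent_ge hq (by nlinarith) (min_le_right _ _))
  obtain ⟨c, hc, hinit⟩ := exists_norm_fourierTr_le_exp_profile hg₀.nonneg hg₀.integrable hg₀.mass
    hR hν hβ hdecay hm0 hm2 hδ (min_le_left ν lam)
  obtain ⟨κ, hκ, hκle⟩ : ∃ κ, 0 < κ ∧
      κ ≤ min c (min (q ^ 4) (profileWeight m δ * (-S p q δ) * q ^ 4)) :=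
    ⟨_, by positivity, le_rfl⟩
  rw [le_min_iff, le_min_iff] at hκle
  have hmain := fun t ht ξ => hg.norm_fourierTr_le_supersolution (m := m) hg₀ hpq hp hq hm0 hm2 hδ
    hκ (fun x hx => exp_profile_defect_le hp hq hqp hpq hm0 hm2 hδ (hδδ'.trans hδ'1) hm hκ
      hκle.2.1 hκle.2.2 hx) (hinit κ hκ hκle.1) (t := t) ht ξ
  -- `1 - z` is the coefficient of `x ^ m` in the profile
  refine ⟨1, κ * (1 - profileWeight m δ), one_pos, mul_pos hκ (by linarith),
    fun t ht ξ => ⟨fun hξ => ?_, fun hξ => ?_⟩⟩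
  · refine (hmain t ht ξ).trans (Real.exp_le_exp.2 ?_)
    have := mul_le_mul_of_nonneg_left (sq_le_profile hm0 hm2 hδ (abs_nonneg ξ) hξ) hκ.le
    rw [sq_abs] at this
    linarith
  · refine (hmain t ht ξ).trans (Real.exp_le_exp.2 ?_)
    rw [profile_of_one_le hξ.le]
    linarith
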